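/- Let $N\ge 1$ and consider $N+1$ qubits $A_1,\dots,A_N,A_{N+1}$ (in this order), with Hilbert space $(\mathbb C^2)^{\otimes (N+1)}$. Let $|\psi^-\rangle=(|01\rangle-|10\rangle)/\sqrt2$ and, for $1\le i\le N$, let $\sigma^{(i)}=2^{-(N-1)}\,|\psi^-\rangle\langle\psi^-|_{A_iA_{N+1}}\otimes I$, $\rho=\sum_{i=1}^N\sigma^{(i)}$, and $$\Pi_i=\rho^{-1/2}\sigma^{(i)}\rho^{-1/2}+\frac1N\Big(I-\sum_{l=1}^N\rho^{-1/2}\sigma^{(l)}\rho^{-1/2}\Big),$$ where $\rho^{-1/2}$ is the inverse square root on the support of $\rho$ and $0$ on its kernel (the square-root measurement of deterministic port-based teleportation). **Schur states.** A label consists of half-integers $\kappa_0,\kappa_1,\dots,\kappa_{N+1}\ge 0$ with $\kappa_0=0$ and $|\kappa_{r+1}-\kappa_r|=\tfrac12$, and of $m\in\{-\kappa_{N+1},-\kappa_{N+1}+1,\dots,\kappa_{N+1}\}$. Write $k=\kappa_{N-1}$, $j=\kappa_N$, $s=\kappa_{N+1}$, and $\tilde k$ for the remaining spins $(\kappa_r)_{r\le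 N-2}$. Identify $|0\rangle,|1\rangle$ with $|x\rangle$, $x=\tfrac12,-\tfrac12$. The Schur state with this label is $$|\tilde k,k,j,s,m\rangle=\sum_{x_1+\dots+x_{N+1}=m}\ \prod_{r=0}^{N}C^{\kappa_{r+1},\,x_1+\dots+x_{r+1}}_{\kappa_r,\,x_1+\dots+x_r;\ \frac12,\,x_{r+1}}\ |x_1\dots x_{N+1}\rangle ,$$ where $C$ denotes the $SU(2)$ Clebsch–Gordan coefficients $$C^{J\pm\frac12,M}_{J,M-\frac12;\frac12,\frac12}=\pm\sqrt{\tfrac12\Big(1\pm\tfrac{M}{J+1/2}\Big)},\qquad C^{J\pm\frac12,M}_{J,M+\frac12;\frac12,-\frac12}=\sqrt{\tfrac12\Big(1\mp\tfrac{M}{J+1/2}\Big)}$$ (and $0$ if the first $Z$-spin exceeds $J$ in absolute value). **Coefficients.** Let $\lambda^-_j=2^{-N}(\tfrac N2-j)$, $\lambda^+_j=2^{-N}(\tfrac N2+j+1)$ and $$\alpha(s)=\frac{\sqrt{s/(2s+1)}}{\sqrt{2^{N-1}\lambda^-_{s-1/2}}},\qquad \beta(s)=-\frac{\sqrt{(s+1)/(2s+1)}}{\sqrt{2^{N-1}\lambda^+_{s+1/2}}}.$$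 Then: 1. The Schur states form an orthonormal basis, and the Schur state with label $(\kappa,m)$ is an eigenvector of the total angular momentum $S^2_{\{1,\dots,r\}}$ of the first $r$ qubits with eigenvalue $\kappa_r(\kappa_r+1)$ for every $0\le r\le N+1$, and of the total $Z$-spin operator with eigenvalue $m$. 2. The following vectors form an orthonormal basis of $(\mathbb C^2)^{\otimes(N+1)}$ and are eigenvectors of $\Pi_N$ with the eigenvalues shown: - the Schur states with $s=\frac{N+1}2$ (maximal spin): eigenvalue $\frac1N$; - the Schur states with $s<\frac{N+1}2$ and $k\ne s$: eigenvalue $0$; - for $k=s\geq\frac12$: $\ \dfrac{\beta(s)\,|\tilde k,s,s-\frac12,s,m\rangle-\alpha(s)\,|\tilde k,s,s+\frac12,s,m\rangle}{\sqrt{\alpha(s)^2+\beta(s)^2}}$: eigenvalue $0$; - for $k=s\geq 0$: $\ \dfrac{\alpha(s)\,|\tilde k,s,s-\frac12,s,m\rangle+\beta(s)\,|\tilde k,s,s+\frac12,s,m\rangle}{\sqrt{\alpha(s)^2+\beta(s)^2}}$: eigenvalue $\alpha(s)^2+\beta(s)^2$ (for $s=0$ the first term is absent, as $\alpha(0)=0$).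 3. For every total spin $s<\frac{N+1}2$ that occurs, $\displaystyle\alpha(s)^2+\beta(s)^2=\frac{4(N+1)}{(N+1-2s)(N+3+2s)}$. 4. For every $1\le i\le N$, $\Pi_i=\mathrm{SWAP}_{A_iA_N}\,\Pi_N\,\mathrm{SWAP}_{A_iA_N}$; hence the images under $\mathrm{SWAP}_{A_iA_N}$ of the vectors in 2 form an orthonormal basis of eigenvectors of $\Pi_i$ with the same eigenvalues. -/

import Mathlib

namespace PBT

noncomputable section

/-! ### Qubits and operators -/

/-- Computational basis labels of `n` qubits. -/
abbrev Bits (n : ℕ) : Type := Fin n → Fin 2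

/-- The Hilbert space `(ℂ²)^{⊗ n}` of `n` qubits. -/
abbrev Qubits (n : ℕ) : Type := EuclideanSpace ℂ (Bits n)

/-- Operators on `n` qubits, written as matrices in the computational basis. -/
abbrev Op (n : ℕ) : Type := Matrix (Bits n) (Bits n) ℂ

/-- The action of an operator on a state vector. -/
def act {n : ℕ} (A : Op n) (v : Qubits n) : Qubits n := Matrix.toEuclideanLin A v

/-- The single-qubit operator `P` acting on qubit `i` (identity on all other qubits). -/
def onQubit {n : ℕ} (i : Fin n) (P : Matrix (Fin 2) (Fin 2) ℂ) : Op n :=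
  Matrix.of fun x y => if ∀ l, l ≠ i → x l = y l then P (x i) (y i) else 0

/-- The Pauli matrices `σ_x, σ_y, σ_z`, indexed by `0, 1, 2`. -/
def pauli : Fin 3 → Matrix (Fin 2) (Fin 2) ℂ :=
  ![!![0, 1; 1, 0], !![0, -Complex.I; Complex.I, 0], !![1, 0; 0, -1]]

/-- The component along axis `c` of the angular momentum of a set `a` of qubits. -/
def spinComp {n : ℕ} (a : Finset (Fin n)) (c : Fin 3) : Op n :=
  ∑ i ∈ a, (1 / 2 : ℂ) • onQubit i (pauli c)

/-- The total angular momentum operator `S²_a`. -/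
def totalSpin {n : ℕ} (a : Finset (Fin n)) : Op n :=
  ∑ c : Fin 3, spinComp a c * spinComp a c

/-- The first `r` qubits. -/
def firstQubits {n : ℕ} (r : Fin (n + 1)) : Finset (Fin n) :=
  Finset.univ.filter fun i => (i : ℕ) < (r : ℕ)

/-- The operator exchanging the qubits `a` and `b`. -/
def swapOp {n : ℕ} (a b : Fin n) : Op n :=
  Matrix.of fun x y => if x = y ∘ Equiv.swap a b then 1 else 0

/-! ### The sequentially coupled Schur basis

All spins and `Z`-spins are half-integers and are stored doubled, as integers. -/

/-- Twice the `Z`-spin of a computational basis state of one qubit: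
`|0⟩` has `Z`-spin `1/2` and `|1⟩` has `Z`-spin `-1/2`. -/
def twiceZ (x : Fin 2) : ℤ := if x = 0 then 1 else -1

/-- The Clebsch-Gordan coefficient `C^{J,M}_{j,m₁; 1/2,m₂}` of `SU(2)`, with `a = 2j`, `p = 2m₁`,
`b = 2J`, `t = 2M`, and `m₂` the `Z`-spin of `|x⟩`. -/
def cgHalf (a : ℕ) (p : ℤ) (x : Fin 2) (b : ℕ) (t : ℤ) : ℝ :=
  if |p| ≤ (a : ℤ) ∧ p + twiceZ x = t then
    if b = a + 1 then
      if x = 0 then √(1 / 2 * (1 + (t : ℝ) / ((a : ℝ) + 1)))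
      else √(1 / 2 * (1 - (t : ℝ) / ((a : ℝ) + 1)))
    else if a = b + 1 then
      if x = 0 then -√(1 / 2 * (1 - (t : ℝ) / ((a : ℝ) + 1)))
      else √(1 / 2 * (1 + (t : ℝ) / ((a : ℝ) + 1)))
    else 0
  else 0

/-- Twice the `Z`-spin of the first `r` qubits in the computational basis state `|x⟩`. -/
def partialZ {n : ℕ} (x : Bits n) (r : Fin (n + 1)) : ℤ :=
  ∑ i ∈ firstQubits r, twiceZ (x i)

/-- The ket `|spin, m⟩` on `n` qubits obtained by coupling the qubits one after the other with
Clebsch-Gordan coefficients: `spin r` is twice the spin of the first `r` qubits (with spin `0` on no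
qubits), `m` is twice the `Z`-spin of all of them. If `spin` has a step other than `± 1`, i.e. if it
breaks the coupling rules, this is the zero vector. -/
def schurKet (n : ℕ) (spin : Fin (n + 1) → ℕ) (m : ℤ) : Qubits n :=
  WithLp.toLp 2 fun x =>
    if partialZ x (Fin.last n) = m then
      ((∏ r : Fin n,
        cgHalf (spin r.castSucc) (partialZ x r.castSucc) (x r) (spin r.succ)
          (partialZ x r.succ) : ℝ) : ℂ)
    else 0

/-- The admissible labels of Schur states on `n` qubits. -/
@[ext]
structure SchurLabel (n : ℕ) where
  /-- twice the spin of the first `r` qubits -/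
  spin : Fin (n + 1) → ℕ
  spin_zero : spin 0 = 0
  spin_step : ∀ r : Fin n, spin r.succ = spin r.castSucc + 1 ∨ spin r.castSucc = spin r.succ + 1
  /-- twice the `Z`-spin of all qubits -/
  m : ℤ
  m_range : |m| ≤ (spin (Fin.last n) : ℤ)
  m_parity : Even ((spin (Fin.last n) : ℤ) - m)

/-- The Schur state with a given label. -/
def schurState {n : ℕ} (x : SchurLabel n) : Qubits n := schurKet n x.spin x.m

/-- A family of vectors is an orthonormal basis. -/
def IsONB {ι : Type} {n : ℕ} (v : ι → Qubits n) : Prop :=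
  Orthonormal ℂ v ∧ Submodule.span ℂ (Set.range v) = ⊤

/-- `v` is an orthonormal simultaneous eigenbasis of `S²_{1,…,r}` (all `r`) and `Z`, whose member
at label `x` has the spins and the `Z`-spin that `x` records. -/
def IsSpinEigenbasis {n : ℕ} (v : SchurLabel n → Qubits n) : Prop :=
  IsONB v ∧
  (∀ (x : SchurLabel n) (r : Fin (n + 1)),
    act (totalSpin (firstQubits r)) (v x) =
      ((x.spin r : ℂ) / 2 * ((x.spin r : ℂ) / 2 + 1)) • v x) ∧
  (∀ x : SchurLabel n, act (spinComp Finset.univ 2) (v x) = ((x.m : ℂ) / 2) • v x)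

/-! ### The square-root measurement

There are `N + 1` qubits: the ports `A_1, …, A_N` are the qubits `i.castSucc`, `i : Fin N`, and the
input `A_{N+1}` is the qubit `Fin.last N`. -/

/-- The singlet `|ψ⁻⟩ = (|01⟩ - |10⟩)/√2`. -/
def singlet (x y : Fin 2) : ℂ :=
  if x = 0 ∧ y = 1 then 1 / ((√2 : ℝ) : ℂ)
  else if x = 1 ∧ y = 0 then -(1 / ((√2 : ℝ) : ℂ)) else 0

/-- `σ^{(i)} = 2^{-(N-1)} |ψ⁻⟩⟨ψ⁻|_{A_i A_{N+1}} ⊗ I`. -/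
def sigma (N : ℕ) (i : Fin N) : Op (N + 1) :=
  ((1 : ℂ) / 2 ^ (N - 1)) • Matrix.of fun x y =>
    if ∀ l, l ≠ i.castSucc → l ≠ Fin.last N → x l = y l then
      singlet (x i.castSucc) (x (Fin.last N)) * star (singlet (y i.castSucc) (y (Fin.last N)))
    else 0

/-- `ρ = ∑ᵢ σ^{(i)}`. -/
def rho (N : ℕ) : Op (N + 1) := ∑ i, sigma N i

/-- `ρ^{-1/2}`, the inverse being taken on the support of `ρ` only (`(√0)⁻¹ = 0`). -/
def rhoInvSqrt (N : ℕ) : Op (N + 1) := cfc (fun t : ℝ => (√t)⁻¹) (rho N)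

/-- `Δ = (I - ∑ᵢ ρ^{-1/2} σ^{(i)} ρ^{-1/2}) / N`. -/
def excess (N : ℕ) : Op (N + 1) :=
  ((1 : ℂ) / N) • (1 - ∑ i, rhoInvSqrt N * sigma N i * rhoInvSqrt N)

/-- The POVM element `Π_i = ρ^{-1/2} σ^{(i)} ρ^{-1/2} + Δ`. -/
def povm (N : ℕ) (i : Fin N) : Op (N + 1) :=
  rhoInvSqrt N * sigma N i * rhoInvSqrt N + excess N

/-- The last port `A_N`. -/
def lastPort (N : ℕ) (hN : 1 ≤ N) : Fin N := ⟨N - 1, by omega⟩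

/-! ### The rotated basis -/

/-- `λ⁻_j = (N/2 - j) / 2^N`. -/
def lamMinus (N : ℕ) (j : ℝ) : ℝ := 1 / 2 ^ N * ((N : ℝ) / 2 - j)

/-- `λ⁺_j = (N/2 + j + 1) / 2^N`. -/
def lamPlus (N : ℕ) (j : ℝ) : ℝ := 1 / 2 ^ N * ((N : ℝ) / 2 + j + 1)

/-- `α(s)`. -/
def alpha (N : ℕ) (s : ℝ) : ℝ :=
  √(s / (2 * s + 1)) / √(2 ^ (N - 1) * lamMinus N (s - 1 / 2))

/-- `β(s)`. -/
def beta (N : ℕ) (s : ℝ) : ℝ :=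
  -√((s + 1) / (2 * s + 1)) / √(2 ^ (N - 1) * lamPlus N (s + 1 / 2))

namespace SchurLabel

variable {N : ℕ}

/-- Twice the spin `k_{N-2}` of the first `N - 1` qubits. -/
def twoK (x : SchurLabel (N + 1)) : ℕ := x.spin ⟨N - 1, by omega⟩

/-- Twice the spin `j` of the first `N` qubits. -/
def twoJ (x : SchurLabel (N + 1)) : ℕ := x.spin ⟨N, by omega⟩

/-- Twice the spin `s` of all `N + 1` qubits. -/
def twoS (x : SchurLabel (N + 1)) : ℕ := x.spin (Fin.last (N + 1))

/-- The spin `s` of all `N + 1` qubits. -/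
def s (x : SchurLabel (N + 1)) : ℝ := (x.twoS : ℝ) / 2

/-- The ket `|k, j, s, m⟩` with `k, s, m` from `x` and with `2j` set to `a`. -/
def ketWithJ (x : SchurLabel (N + 1)) (a : ℕ) : Qubits (N + 1) :=
  schurKet (N + 1) (Function.update x.spin ⟨N, by omega⟩ a) x.m

/-- `|k̃, s, s - 1/2, s, m⟩`. For `s = 0` no such state exists and the vector below is zero (the
natural subtraction returns `2j = 0`, which breaks the coupling rules). -/
def lowerKet (x : SchurLabel (N + 1)) : Qubits (N + 1) := x.ketWithJ (x.twoS - 1)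

/-- `|k̃, s, s + 1/2, s, m⟩`. -/
def upperKet (x : SchurLabel (N + 1)) : Qubits (N + 1) := x.ketWithJ (x.twoS + 1)

/-- `√(α(s)² + β(s)²)`. -/
def rotNorm (x : SchurLabel (N + 1)) : ℝ := √(alpha N x.s ^ 2 + beta N x.s ^ 2)

/-- `(β(s) |k̃, s, s - 1/2, s, m⟩ - α(s) |k̃, s, s + 1/2, s, m⟩) / √(α(s)² + β(s)²)`. -/
def rotMinus (x : SchurLabel (N + 1)) : Qubits (N + 1) :=
  ((beta N x.s / x.rotNorm : ℝ) : ℂ) • x.lowerKet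
    - ((alpha N x.s / x.rotNorm : ℝ) : ℂ) • x.upperKet

/-- `(α(s) |k̃, s, s - 1/2, s, m⟩ + β(s) |k̃, s, s + 1/2, s, m⟩) / √(α(s)² + β(s)²)`. -/
def rotPlus (x : SchurLabel (N + 1)) : Qubits (N + 1) :=
  ((alpha N x.s / x.rotNorm : ℝ) : ℂ) • x.lowerKet
    + ((beta N x.s / x.rotNorm : ℝ) : ℂ) • x.upperKet

/-- The rotated basis: Schur states with `k_{N-2} ≠ s` (in particular those of maximal spin) are
kept, and each pair of Schur states with `k_{N-2} = s`, `j = s ∓ 1/2` is rotated. -/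
def eigVec (x : SchurLabel (N + 1)) : Qubits (N + 1) :=
  if x.twoK = x.twoS then
    if x.twoJ + 1 = x.twoS then x.rotMinus else x.rotPlus
  else schurState x

/-- The eigenvalues: `1/N` at maximal spin, `α(s)² + β(s)²` at the vectors `rotPlus`, else `0`. -/
def eigVal (x : SchurLabel (N + 1)) : ℝ :=
  if x.twoS = N + 1 then 1 / N
  else if x.twoK = x.twoS ∧ x.twoJ = x.twoS + 1 then alpha N x.s ^ 2 + beta N x.s ^ 2
  else 0

end SchurLabel

end

end PBT

/-! The singlet projector is half of one minus the exchange, so σ^{(i)} = 2^{-N}(1 - SWAP_{A_i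
A_{N+1}}) (`sigma_eq`) and ρ = 2^{-N}(N - X), where X is the sum of the exchanges of the input with
the ports, a Jucys-Murphy element (`rho_eq`). Everything thus reduces to the action of exchanges on
Schur kets.

Let the last two qubits be coupled along k → j → s. If k ≠ s they form a triplet and their exchange
acts trivially (`swap_ket_of_ne`). If k = s, the paths through j = s ± 1/2 span a plane (a line for
s = 0) on which 1 - SWAP has rank one, along the vector of singlet amplitudes (`swap_ket_of_eq`).
Together with the recursion X' = τXτ + τ, τ the exchange of the last two qubits, this makes every
Schur ket an eigenvector of all Jucys-Murphy elements (`jucysMurphy_ket`). Adding a qubit changes S²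
by such an element plus a constant (`totalSpin_insert`), which gives the spins. Orthonormality and
completeness follow by induction on the number of qubits from row and column orthogonality of the
Clebsch-Gordan coefficients (`amp_orthogonal`, `eq_zero_of_amp_orthogonal`).

Hence ρ is diagonal on Schur kets, with the maximal spin sector as kernel, and ρ^{-1/2} acts by
scalars (`act_cfc`). The excess term is 1/N times the projector on that kernel (`excess_ket`). On a
plane k = s the operator Π_N is |w⟩⟨w| with w = α|j = s - 1/2⟩ + β|j = s + 1/2⟩ (`povm_ket_of_eq`):
w has eigenvalue α² + β², and the orthogonal vector has eigenvalue 0. The remaining Π_i follow from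
the invariance of ρ under permutations of the ports (`povm_conj`).

In the proof, spins are doubled and paths of spins are functions on ℕ, so that dropping the last
qubit needs no reindexing. -/

namespace PBT

noncomputable section

/-! ### Clebsch-Gordan coefficients -/

/-- The amplitude `√((1 + t / (a + 1)) / 2)`. -/
def cgU (a : ℕ) (t : ℤ) : ℝ := √((a : ℝ) + 1 + t) / √(2 * ((a : ℝ) + 1))

/-- The amplitude `√((1 - t / (a + 1)) / 2)`. -/
def cgD (a : ℕ) (t : ℤ) : ℝ := √((a : ℝ) + 1 - t) / √(2 * ((a : ℝ) + 1))

lemma sqrt_half_add (a : ℕ) (t : ℤ) : √(1 / 2 * (1 + (t : ℝ) / ((a : ℝ) + 1))) = cgU a t := by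
  rw [cgU, ← Real.sqrt_div' _ (by positivity)]
  congr 1
  field_simp

lemma sqrt_half_sub (a : ℕ) (t : ℤ) : √(1 / 2 * (1 - (t : ℝ) / ((a : ℝ) + 1))) = cgD a t := by
  rw [cgD, ← Real.sqrt_div' _ (by positivity)]
  congr 1
  field_simp

lemma cgU_eq_zero {a : ℕ} {t : ℤ} (h : t = -(a + 1)) : cgU a t = 0 := by
  subst h; simp [cgU]

lemma cgD_eq_zero {a : ℕ} {t : ℤ} (h : t = a + 1) : cgD a t = 0 := by
  subst h; simp [cgD]

lemma cgU_sq_add_cgD_sq {a : ℕ} {t : ℤ} (h : |t| ≤ (a : ℤ) + 1) :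
    cgU a t * cgU a t + cgD a t * cgD a t = 1 := by
  obtain ⟨h1, h2⟩ := abs_le.mp h
  have h1' : (-((a : ℝ) + 1)) ≤ t := by exact_mod_cast h1
  have h2' : (t : ℝ) ≤ a + 1 := by exact_mod_cast h2
  rw [cgU, cgD, div_mul_div_comm, div_mul_div_comm, Real.mul_self_sqrt (by linarith),
    Real.mul_self_sqrt (by linarith), Real.mul_self_sqrt (by positivity)]
  field_simp
  ring

lemma twiceZ_zero : twiceZ 0 = 1 := rfl

lemma twiceZ_one : twiceZ 1 = -1 := rfl

/-- The guard in `cgHalf` bounds the first Z-spin. By parity it differs from a bound on the total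
Z-spin only at an endpoint, where the amplitude vanishes anyway. -/
lemma cgHalf_up (a : ℕ) (b : Fin 2) (t : ℤ) (ht : Even ((a : ℤ) + 1 - t)) :
    cgHalf a (t - twiceZ b) b (a + 1) t =
      if |t| ≤ (a : ℤ) + 1 then (if b = 0 then cgU a t else cgD a t) else 0 := by
  have e : t - twiceZ b + twiceZ b = t := by ring
  obtain ⟨c, hc⟩ := ht
  simp only [cgHalf, e, and_true, if_true, sqrt_half_add, sqrt_half_sub]
  fin_cases b
  · simp only [Fin.zero_eta, twiceZ_zero, if_true]
    split_ifs with h1 h2 h2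
    · rfl
    · rw [abs_le] at *; omega
    · rw [abs_le] at *; rw [cgU_eq_zero]; omega
    · rfl
  · simp only [Fin.mk_one, twiceZ_one, one_ne_zero, if_false]
    split_ifs with h1 h2 h2
    · rfl
    · rw [abs_le] at *; omega
    · rw [abs_le] at *; rw [cgD_eq_zero]; omega
    · rfl

/-- Again the two guards differ, within the right parity, only where the amplitude is zero. -/
lemma cgHalf_down (a : ℕ) (b : Fin 2) (t : ℤ) (ht : Even ((a : ℤ) - t)) :
    cgHalf (a + 1) (t - twiceZ b) b a t =
      if |t| ≤ (a : ℤ) then (if b = 0 then -cgD (a + 1) t else cgU (a + 1) t) else 0 := by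
  have e : t - twiceZ b + twiceZ b = t := by ring
  obtain ⟨c, hc⟩ := ht
  simp only [cgHalf, e, and_true, if_true, sqrt_half_add, sqrt_half_sub,
    show ¬ (a = a + 1 + 1) by omega, if_false]
  fin_cases b
  · simp only [Fin.zero_eta, twiceZ_zero, if_true]
    split_ifs with h1 h2 h2
    · rfl
    · rw [abs_le] at *; rw [cgD_eq_zero, neg_zero]; push_cast at *; omega
    · rw [abs_le] at *; push_cast at *; omega
    · rfl
  · simp only [Fin.mk_one, twiceZ_one, one_ne_zero, if_false]
    split_ifs with h1 h2 h2
    · rfl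
    · rw [abs_le] at *; rw [cgU_eq_zero]; push_cast at *; omega
    · rw [abs_le] at *; push_cast at *; omega
    · rfl

/-- Two consecutive spins (doubled) allowed by the coupling rule. -/
def Step (a b : ℕ) : Prop := b = a + 1 ∨ a = b + 1

lemma cgHalf_eq_zero_of_not_step {a b : ℕ} (h : ¬ Step a b) (p : ℤ) (x : Fin 2) (t : ℤ) :
    cgHalf a p x b t = 0 := by
  simp only [Step, not_or] at h
  simp [cgHalf, h.1, h.2]

/-- Clebsch-Gordan coefficients vanish outside the range of the `Z`-spin. -/
lemma cgHalf_eq_zero {a B : ℕ} (h : Step a B) (b : Fin 2) {t : ℤ} (ht : Even ((B : ℤ) - t))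
    (hB : ¬ |t| ≤ (B : ℤ)) : cgHalf a (t - twiceZ b) b B t = 0 := by
  rcases h with rfl | rfl
  · rw [cgHalf_up _ _ _ (by exact_mod_cast ht), if_neg (by exact_mod_cast hB)]
  · rw [cgHalf_down _ _ _ ht, if_neg hB]

/-- Row orthogonality of the Clebsch-Gordan coefficients. -/
lemma cgHalf_orthogonal {a B C : ℕ} (hB : Step a B) (hC : Step a C) {t : ℤ}
    (ht : Even ((a : ℤ) + 1 - t)) :
    ∑ b : Fin 2, cgHalf a (t - twiceZ b) b B t * cgHalf a (t - twiceZ b) b C t =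
      if B = C ∧ |t| ≤ (B : ℤ) then 1 else 0 := by
  have key : ∀ a' : ℕ, a = a' + 1 → Even ((a' : ℤ) - t) := by
    rintro a' rfl
    obtain ⟨c, hc⟩ := ht
    exact ⟨c - 1, by push_cast at hc; omega⟩
  have lt : ∀ a' : ℕ, |t| ≤ (a' : ℤ) → |t| ≤ ((a' + 1 : ℕ) : ℤ) + 1 := fun _ h => by
    push_cast; omega
  rcases hB with rfl | rfl <;> rcases hC with hC | hC
  · subst hC
    simp only [cgHalf_up _ _ _ ht, Fin.sum_univ_two, true_and, Nat.cast_add, Nat.cast_one]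
    split_ifs with h <;> simp_all [cgU_sq_add_cgD_sq]
  · subst hC
    simp only [cgHalf_up _ _ _ ht, cgHalf_down _ _ _ (key _ rfl), Fin.sum_univ_two]
    rw [if_neg (by omega : ¬ (C + 1 + 1 = C ∧ _))]
    split_ifs <;> simp_all
    ring
  · subst hC
    simp only [cgHalf_up _ _ _ ht, cgHalf_down _ _ _ (key _ rfl), Fin.sum_univ_two]
    rw [if_neg (by omega : ¬ (B = B + 1 + 1 ∧ _))]
    split_ifs <;> simp_all
    ring
  · obtain rfl : B = C := by omega
    simp only [cgHalf_down _ _ _ (key _ rfl), Fin.sum_univ_two, true_and]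
    by_cases h : |t| ≤ (B : ℤ) <;> simp only [h, if_true, if_false]
    · have := cgU_sq_add_cgD_sq (lt _ h)
      simp only [one_ne_zero, if_false, neg_mul_neg]
      linarith
    · simp

/-- Column orthogonality of the Clebsch-Gordan coefficients. -/
lemma cgHalf_complete {a : ℕ} {t : ℤ} (ht : Even ((a : ℤ) + 1 - t)) (b c : Fin 2)
    (hb : |t - twiceZ b| ≤ (a : ℤ)) :
    cgHalf a (t - twiceZ b) b (a + 1) t * cgHalf a (t - twiceZ c) c (a + 1) t +
      cgHalf a (t - twiceZ b) b (a - 1) t * cgHalf a (t - twiceZ c) c (a - 1) t =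
      if b = c then 1 else 0 := by
  have hz : twiceZ b = 1 ∨ twiceZ b = -1 := by fin_cases b <;> simp [twiceZ]
  have hta : |t| ≤ (a : ℤ) + 1 := by rw [abs_le] at *; omega
  have hsq := cgU_sq_add_cgD_sq hta
  simp only [cgHalf_up _ _ _ ht, if_pos hta]
  obtain ⟨r, hr⟩ := ht
  -- In the interior both couplings occur and form an orthogonal 2 × 2 matrix. At t = ±(a + 1) only
  -- a → a + 1 survives, and a single value of the qubit is possible.
  by_cases hin : |t| + 1 ≤ (a : ℤ)
  · obtain ⟨a, rfl⟩ : ∃ a', a = a' + 1 := ⟨a - 1, by have := abs_nonneg t; omega⟩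
    rw [Nat.add_sub_cancel, cgHalf_down _ _ _ ⟨r - 1, by push_cast at hr; omega⟩,
      cgHalf_down _ _ _ ⟨r - 1, by push_cast at hr; omega⟩]
    have hin' : |t| ≤ (a : ℤ) := by push_cast at hin; omega
    simp only [if_pos hin']
    fin_cases b <;> fin_cases c <;> simp <;> linarith
  · have hz' : cgHalf a (t - twiceZ c) c (a - 1) t = 0 := by
      -- For a = 0 the truncated a - 1 is 0, and 0 → 0 is not a coupling step, so the coefficient is
      -- zero as required.
      rcases Nat.eq_zero_or_pos a with rfl | ha
      · exact cgHalf_eq_zero_of_not_step (by simp [Step]) _ _ _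
      · refine cgHalf_eq_zero (Or.inr (by omega)) _ ⟨r - 1, by omega⟩ (by omega)
    rw [hz', mul_zero, add_zero]
    rcases abs_cases t with ⟨h1, h2⟩ | ⟨h1, h2⟩
    · have : t = a + 1 := by omega
      have hD := cgD_eq_zero this
      rw [hD] at hsq
      fin_cases b
      · fin_cases c <;> simp_all
      · rw [abs_le] at hb; simp [twiceZ] at hb; omega
    · have : t = -(a + 1) := by omega
      have hU := cgU_eq_zero this
      rw [hU] at hsq
      fin_cases b
      · rw [abs_le] at hb; simp [twiceZ] at hb; omega
      · fin_cases c <;> simp_all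

/-! ### Coupling two further qubits -/

/-- The Clebsch-Gordan amplitude for coupling two further qubits `b`, `c` along `k → j → s`. -/
def cgPair (k j s : ℕ) (m : ℤ) (b c : Fin 2) : ℝ :=
  cgHalf k (m - twiceZ c - twiceZ b) b j (m - twiceZ c) * cgHalf j (m - twiceZ c) c s m

/-- The singlet amplitude `√((a + 2) / (a + 1))` of the path `a → a + 1 → a`. -/
def singletUp (a : ℕ) : ℝ := √((a : ℝ) + 2) / √((a : ℝ) + 1)

/-- The singlet amplitude `-√(a / (a + 1))` of the path `a → a - 1 → a`. -/
def singletDown (a : ℕ) : ℝ := -(√(a : ℝ) / √((a : ℝ) + 1))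

/-- The singlet amplitude of the path `a → j → a`. -/
def singletAmp (a j : ℕ) : ℝ := if j = a + 1 then singletUp a else singletDown a

/-- When k ≠ s both steps go in the same direction, so the two added qubits carry joint spin 1, and
triplet states are symmetric. -/
lemma cgPair_comm_of_ne {k j s : ℕ} (hkj : Step k j) (hjs : Step j s) (hks : k ≠ s) {m : ℤ}
    (hm : |m| ≤ (k : ℤ)) (hpar : Even ((k : ℤ) - m)) :
    cgPair k j s m 0 1 = cgPair k j s m 1 0 := by
  obtain ⟨r, hr⟩ := hpar
  simp only [cgPair, twiceZ_zero, twiceZ_one]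
  rcases hkj with rfl | rfl <;> rcases hjs with hs | hs
  · subst hs
    have e1 := cgHalf_up k 0 (m - -1) ⟨r, by omega⟩
    have e2 := cgHalf_up k 1 (m - 1) ⟨r + 1, by omega⟩
    have e3 := cgHalf_up (k + 1) 1 m ⟨r + 1, by push_cast; omega⟩
    have e4 := cgHalf_up (k + 1) 0 m ⟨r + 1, by push_cast; omega⟩
    simp only [twiceZ_zero, twiceZ_one] at e1 e2 e3 e4
    rw [e1, e2, e3, e4]
    rw [abs_le] at hm
    rw [if_pos (abs_le.mpr (by omega)), if_pos (abs_le.mpr (by push_cast; omega)),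
      if_pos (abs_le.mpr (by omega)), if_pos (abs_le.mpr (by push_cast; omega))]
    simp only [if_true, one_ne_zero, if_false, cgU, cgD]
    push_cast
    rw [show (k : ℝ) + 1 + (m - -1) = k + 1 + 1 + m by ring,
      show (k : ℝ) + 1 - (m - 1) = k + 1 + 1 - m by ring]
    ring
  · omega
  · omega
  · subst hs
    have e1 := cgHalf_down (s + 1) 0 (m - -1) ⟨r - 1, by push_cast at *; omega⟩
    have e2 := cgHalf_down (s + 1) 1 (m - 1) ⟨r, by push_cast at *; omega⟩
    have e3 := cgHalf_down s 1 m ⟨r - 1, by push_cast at *; omega⟩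
    have e4 := cgHalf_down s 0 m ⟨r - 1, by push_cast at *; omega⟩
    simp only [twiceZ_zero, twiceZ_one] at e1 e2 e3 e4
    rw [e1, e2, e3, e4]
    by_cases h : |m| ≤ (s : ℤ)
    · rw [abs_le] at h
      rw [if_pos (abs_le.mpr (by push_cast; omega)), if_pos (abs_le.mpr (by omega)),
        if_pos (abs_le.mpr (by push_cast; omega)), if_pos (abs_le.mpr (by omega))]
      simp only [if_true, one_ne_zero, if_false, cgU, cgD]
      push_cast
      rw [show (s : ℝ) + 1 + 1 + 1 - (m - -1) = s + 1 + 1 - m by ring,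
        show (s : ℝ) + 1 + 1 + 1 + (m - 1) = s + 1 + 1 + m by ring]
      ring
    · simp [h]

lemma sqrt_mul_sqrt_two_mul (x y : ℝ) :
    √(2 * x) * √(2 * y) = 2 * (√x * √y) := by
  rw [Real.sqrt_mul (by norm_num), Real.sqrt_mul (by norm_num)]
  linear_combination (√x * √y) * Real.mul_self_sqrt (show (0 : ℝ) ≤ 2 by norm_num)

lemma cgPair_up (a : ℕ) (m : ℤ) (hpar : Even ((a : ℤ) - m)) (b c : Fin 2) :
    cgPair a (a + 1) a m b c = if |m| ≤ (a : ℤ) then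
      (if b = 0 then √((a : ℝ) + 1 + (m - twiceZ c)) else √((a : ℝ) + 1 - (m - twiceZ c))) *
      (if c = 0 then -√((a : ℝ) + 2 - m) else √((a : ℝ) + 2 + m)) /
        (2 * (√((a : ℝ) + 1) * √((a : ℝ) + 2))) else 0 := by
  obtain ⟨r, hr⟩ := hpar
  have hz : twiceZ c = 1 ∨ twiceZ c = -1 := by fin_cases c <;> simp [twiceZ]
  rw [cgPair, cgHalf_up, cgHalf_down _ _ _ ⟨r, hr⟩]
  · by_cases h : |m| ≤ (a : ℤ)
    · have h' : |m - twiceZ c| ≤ (a : ℤ) + 1 := by rw [abs_le] at *; omega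
      rw [if_pos h, if_pos h, if_pos h']
      rw [← sqrt_mul_sqrt_two_mul]
      simp only [cgU, cgD]
      push_cast
      rw [show (a : ℝ) + 1 + 1 = a + 2 by ring]
      split_ifs <;> ring
    · simp [h]
  · rcases hz with h | h
    · exact ⟨r + 1, by omega⟩
    · exact ⟨r, by omega⟩

lemma cgPair_down (a : ℕ) (m : ℤ) (hpar : Even ((a : ℤ) + 1 - m)) (b c : Fin 2)
    (hm : |m - twiceZ c - twiceZ b| ≤ (a : ℤ) + 1) :
    cgPair (a + 1) a (a + 1) m b c = if |m| ≤ (a : ℤ) + 1 then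
      (if b = 0 then -√((a : ℝ) + 2 - (m - twiceZ c)) else √((a : ℝ) + 2 + (m - twiceZ c))) *
      (if c = 0 then √((a : ℝ) + 1 + m) else √((a : ℝ) + 1 - m)) /
        (2 * (√((a : ℝ) + 2) * √((a : ℝ) + 1))) else 0 := by
  obtain ⟨r, hr⟩ := hpar
  rw [cgPair, cgHalf_up _ _ _ ⟨r, hr⟩, cgHalf_down]
  · by_cases h : |m| ≤ (a : ℤ) + 1
    · rw [if_pos h, if_pos h]
      by_cases h' : |m - twiceZ c| ≤ (a : ℤ)
      · rw [if_pos h']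
        rw [← sqrt_mul_sqrt_two_mul]
        simp only [cgU, cgD]
        push_cast
        rw [show (a : ℝ) + 1 + 1 = a + 2 by ring]
        split_ifs <;> ring
      -- The intermediate Z-spin leaves its range only at m = ∓(a + 1), where a square root in the
      -- closed form vanishes.
      · rw [if_neg h', zero_mul]
        symm
        rw [div_eq_zero_iff]
        left
        fin_cases c
        · simp only [Fin.zero_eta, twiceZ_zero, if_true] at *
          have : m = -(a + 1) := by rw [abs_le] at *; omega
          subst this
          simp
        · simp only [Fin.mk_one, twiceZ_one] at *
          have : m = a + 1 := by rw [abs_le] at *; omega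
          subst this
          simp
    · simp [h]
  · have hz : twiceZ c = 1 ∨ twiceZ c = -1 := by fin_cases c <;> simp [twiceZ]
    rcases hz with h | h
    · exact ⟨r, by omega⟩
    · exact ⟨r - 1, by omega⟩

lemma singletUp_sq (a : ℕ) : singletUp a * singletUp a = ((a : ℝ) + 2) / (a + 1) := by
  rw [singletUp, div_mul_div_comm, Real.mul_self_sqrt (by positivity),
    Real.mul_self_sqrt (by positivity)]

lemma singletDown_sq (a : ℕ) : singletDown a * singletDown a = (a : ℝ) / (a + 1) := by
  rw [singletDown, neg_mul_neg, div_mul_div_comm, Real.mul_self_sqrt (by positivity),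
    Real.mul_self_sqrt (by positivity)]

/-- This is the overlap of the added pair with the unnormalized singlet |01⟩ - |10⟩. It does not
depend on m because the singlet is rotation invariant. -/
lemma cgPair_up_sub (a : ℕ) {m : ℤ} (hm : |m| ≤ (a : ℤ)) (hpar : Even ((a : ℤ) - m)) :
    cgPair a (a + 1) a m 0 1 - cgPair a (a + 1) a m 1 0 = singletUp a := by
  have hm' : |(m : ℝ)| ≤ a := by exact_mod_cast hm
  obtain ⟨h1, h2⟩ := abs_le.mp hm'
  rw [cgPair_up _ _ hpar, cgPair_up _ _ hpar, if_pos hm, if_pos hm]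
  simp only [if_true, one_ne_zero, if_false, twiceZ_zero, twiceZ_one, singletUp]
  push_cast
  rw [show (a : ℝ) + 1 + (m - -1) = a + 2 + m by ring,
    show (a : ℝ) + 1 - (m - 1) = a + 2 - m by ring, mul_neg, Real.mul_self_sqrt (by linarith),
    Real.mul_self_sqrt (by linarith)]
  have h3 : √((a : ℝ) + 1) ≠ 0 := by positivity
  have h4 : √((a : ℝ) + 2) ≠ 0 := by positivity
  have h5 := Real.mul_self_sqrt (show (0 : ℝ) ≤ a + 2 by positivity)
  field_simp
  linear_combination (-2) * h5

lemma cgPair_down_sub (a : ℕ) {m : ℤ} (hm : |m| ≤ (a : ℤ) + 1) (hpar : Even ((a : ℤ) + 1 - m)) :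
    cgPair (a + 1) a (a + 1) m 0 1 - cgPair (a + 1) a (a + 1) m 1 0 = singletDown (a + 1) := by
  have hm' : |(m : ℝ)| ≤ a + 1 := by exact_mod_cast hm
  obtain ⟨h1, h2⟩ := abs_le.mp hm'
  rw [cgPair_down _ _ hpar _ _ (by simpa [twiceZ] using hm),
    cgPair_down _ _ hpar _ _ (by simpa [twiceZ] using hm), if_pos hm, if_pos hm]
  simp only [if_true, one_ne_zero, if_false, twiceZ_zero, twiceZ_one, singletDown]
  push_cast
  rw [show (a : ℝ) + 2 - (m - -1) = a + 1 - m by ring,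
    show (a : ℝ) + 2 + (m - 1) = a + 1 + m by ring, neg_mul, Real.mul_self_sqrt (by linarith),
    Real.mul_self_sqrt (by linarith), show (a : ℝ) + 1 + 1 = a + 2 by ring]
  have h3 : √((a : ℝ) + 1) ≠ 0 := by positivity
  have h4 : √((a : ℝ) + 2) ≠ 0 := by positivity
  have h5 := Real.mul_self_sqrt (show (0 : ℝ) ≤ a + 1 by positivity)
  field_simp
  linear_combination 2 * h5

/-- The singlet amplitudes on the two paths `a → a ± 1 → a` add up to the singlet. -/
lemma cgPair_singlet (a : ℕ) (b c : Fin 2) {m : ℤ} (hm : |m - twiceZ c - twiceZ b| ≤ (a : ℤ))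
    (hpar : Even ((a : ℤ) - m)) :
    singletUp a * cgPair a (a + 1) a m b c + singletDown a * cgPair a (a - 1) a m b c =
      if b = c then 0 else if b = 0 then 1 else -1 := by
  have h3 : √((a : ℝ) + 1) ≠ 0 := by positivity
  have h4 : √((a : ℝ) + 2) ≠ 0 := by positivity
  have s3 := Real.mul_self_sqrt (show (0 : ℝ) ≤ a + 1 by positivity)
  rcases Nat.eq_zero_or_pos a with rfl | ha
  -- For a = 0 there is no path through a - 1; its singlet amplitude vanishes and removes the
  -- meaningless term.
  · rw [show singletDown 0 = 0 by simp [singletDown], zero_mul, add_zero, cgPair_up _ _ hpar]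
    have h2 : √(2 : ℝ) ≠ 0 := by positivity
    fin_cases b <;> fin_cases c <;> simp [twiceZ, abs_le, singletUp] at *
    · intro _ _; omega
    · obtain rfl : m = 0 := by omega
      norm_num
      field_simp
    · obtain rfl : m = 0 := by omega
      norm_num
      field_simp
    · intro _ _; omega
  · obtain ⟨a, rfl⟩ : ∃ a', a = a' + 1 := ⟨a - 1, by omega⟩
    rw [Nat.add_sub_cancel, cgPair_up _ _ hpar,
      cgPair_down _ _ (by exact_mod_cast hpar) _ _ (by exact_mod_cast hm), singletUp, singletDown]
    push_cast at *
    rw [show (a : ℝ) + 1 + 2 = a + 3 by ring, show (a : ℝ) + 1 + 1 = a + 2 by ring] at *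
    have h5 : √((a : ℝ) + 1) ≠ 0 := by positivity
    by_cases h : |m| ≤ (a : ℤ) + 1
    · have hm' : |(m : ℝ)| ≤ a + 1 := by exact_mod_cast h
      obtain ⟨l1, l2⟩ := abs_le.mp hm'
      rw [if_pos h, if_pos h]
      fin_cases b <;> fin_cases c <;> simp [twiceZ] at *
      · rw [show (a : ℝ) + 2 + (m - 1) = a + 1 + m by ring,
          show (a : ℝ) + 2 - (m - 1) = a + 3 - m by ring]
        field_simp
        ring
      · rw [show (a : ℝ) + 2 + (m + 1) = a + 3 + m by ring,
          show (a : ℝ) + 2 - (m + 1) = a + 1 - m by ring,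
          Real.mul_self_sqrt (by linarith), Real.mul_self_sqrt (by linarith)]
        field_simp
        linear_combination (-2) * s3
      · rw [show (a : ℝ) + 2 + (m - 1) = a + 1 + m by ring,
          show (a : ℝ) + 2 - (m - 1) = a + 3 - m by ring,
          Real.mul_self_sqrt (by linarith), Real.mul_self_sqrt (by linarith)]
        field_simp
        linear_combination 2 * s3
      · rw [show (a : ℝ) + 2 + (m + 1) = a + 3 + m by ring,
          show (a : ℝ) + 2 - (m + 1) = a + 1 - m by ring]
        field_simp
        ring
    · rw [if_neg h, if_neg h, mul_zero, mul_zero, add_zero]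
      fin_cases b <;> fin_cases c <;> simp [twiceZ] at * <;> omega

/-- Exchanging the two added qubits, for coupling paths that return to the initial spin. -/
lemma cgPair_sub_swap {a j : ℕ} (hj : Step a j) (b c : Fin 2) {m : ℤ}
    (hm : |m - twiceZ c - twiceZ b| ≤ (a : ℤ)) (hpar : Even ((a : ℤ) - m)) :
    cgPair a j a m b c - cgPair a j a m c b =
      singletAmp a j * (singletUp a * cgPair a (a + 1) a m b c +
        singletDown a * cgPair a (a - 1) a m b c) := by
  -- On two qubits, one minus the exchange is the rank-one operator built from |01⟩ - |10⟩, so only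
  -- the overlap with that vector has to be computed.
  rw [cgPair_singlet a b c hm hpar]
  have key : |m| ≤ (a : ℤ) → cgPair a j a m 0 1 - cgPair a j a m 1 0 = singletAmp a j := by
    intro h
    rcases hj with rfl | rfl
    · rw [cgPair_up_sub a h hpar, singletAmp, if_pos rfl]
    · rw [cgPair_down_sub j (by exact_mod_cast h) (by exact_mod_cast hpar), singletAmp,
        if_neg (by omega)]
  fin_cases b <;> fin_cases c <;> simp [twiceZ] at *
  · exact key hm
  · linarith [key hm]

/-! ### Amplitudes of the Schur kets -/

/-- Twice the spins `κ 0, …, κ n` obey the coupling rules. -/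
def Path (n : ℕ) (κ : ℕ → ℕ) : Prop := κ 0 = 0 ∧ ∀ r < n, Step (κ r) (κ (r + 1))

/-- The amplitudes of a Schur ket in the computational basis, by recursion on the number of
qubits. -/
def amp : (n : ℕ) → (ℕ → ℕ) → ℤ → Bits n → ℝ
  | 0, _, m, _ => if m = 0 then 1 else 0
  | n + 1, κ, m, x =>
    amp n κ (m - twiceZ (x (Fin.last n))) (Fin.init x) *
      cgHalf (κ n) (m - twiceZ (x (Fin.last n))) (x (Fin.last n)) (κ (n + 1)) m

lemma amp_succ (n : ℕ) (κ : ℕ → ℕ) (m : ℤ) (x : Bits (n + 1)) :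
    amp (n + 1) κ m x = amp n κ (m - twiceZ (x (Fin.last n))) (Fin.init x) *
      cgHalf (κ n) (m - twiceZ (x (Fin.last n))) (x (Fin.last n)) (κ (n + 1)) m := rfl

lemma amp_snoc (n : ℕ) (κ : ℕ → ℕ) (m : ℤ) (y : Bits n) (b : Fin 2) :
    amp (n + 1) κ m (Fin.snoc y b : Bits (n + 1)) = amp n κ (m - twiceZ b) y *
      cgHalf (κ n) (m - twiceZ b) b (κ (n + 1)) m := by
  rw [amp_succ, Fin.snoc_last, Fin.init_snoc (α := fun _ => Fin 2)]

lemma Path.init {n : ℕ} {κ : ℕ → ℕ} (h : Path (n + 1) κ) : Path n κ :=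
  ⟨h.1, fun r hr => h.2 r (by omega)⟩

lemma Path.step {n : ℕ} {κ : ℕ → ℕ} (h : Path (n + 1) κ) : Step (κ n) (κ (n + 1)) :=
  h.2 n (by omega)

lemma Path.le {n : ℕ} {κ : ℕ → ℕ} (h : Path n κ) : κ n ≤ n := by
  induction n with
  | zero => exact h.1.le
  | succ n ih =>
    have := ih h.init
    rcases h.step with h | h <;> omega

lemma amp_congr {n : ℕ} {κ κ' : ℕ → ℕ} (h : ∀ r ≤ n, κ r = κ' r) (m : ℤ) (x : Bits n) :
    amp n κ m x = amp n κ' m x := by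
  induction n generalizing m with
  | zero => rfl
  | succ n ih =>
    rw [amp_succ, amp_succ, ih (fun r hr => h r (by omega)), h n (by omega), h (n + 1) le_rfl]

/-- The `Z`-spin of a Schur ket with nonzero amplitudes has the parity of the spin. -/
lemma amp_parity {n : ℕ} {κ : ℕ → ℕ} (h : Path n κ) {m : ℤ} {x : Bits n}
    (hx : amp n κ m x ≠ 0) : Even ((κ n : ℤ) - m) := by
  induction n generalizing m with
  | zero =>
    have : m = 0 := by
      by_contra h0
      exact hx (by simp [amp, h0])
    simp [this, h.1]
  | succ n ih =>
    rw [amp_succ] at hx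
    obtain ⟨r, hr⟩ := ih h.init (left_ne_zero_of_mul hx)
    have hz : twiceZ (x (Fin.last n)) = 1 ∨ twiceZ (x (Fin.last n)) = -1 := by
      rw [twiceZ]; split_ifs <;> simp
    rcases h.step with h1 | h1 <;> rcases hz with h2 | h2
    · exact ⟨r, by omega⟩
    · exact ⟨r + 1, by omega⟩
    · exact ⟨r - 1, by omega⟩
    · exact ⟨r, by omega⟩

/-- The `Z`-spin of a Schur ket with nonzero amplitudes is bounded by the spin. -/
lemma amp_range {n : ℕ} {κ : ℕ → ℕ} (h : Path n κ) {m : ℤ} {x : Bits n}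
    (hx : amp n κ m x ≠ 0) : |m| ≤ (κ n : ℤ) := by
  cases n with
  | zero =>
    have : m = 0 := by
      by_contra h0
      exact hx (by simp [amp, h0])
    simp [this]
  | succ n =>
    by_contra h0
    have hp := amp_parity h hx
    rw [amp_succ] at hx
    exact right_ne_zero_of_mul hx (cgHalf_eq_zero h.step _ hp h0)

lemma sum_bits_succ {M : Type*} [AddCommMonoid M] {n : ℕ} (f : Bits (n + 1) → M) :
    ∑ x, f x = ∑ b : Fin 2, ∑ y : Bits n, f (Fin.snoc y b : Bits (n + 1)) := by
  rw [← (Fin.snocEquiv (fun _ : Fin (n + 1) => Fin 2)).sum_comp, Fintype.sum_prod_type]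
  rfl

/-- Schur kets are orthonormal. -/
lemma amp_orthogonal {n : ℕ} {κ κ' : ℕ → ℕ} (h : Path n κ) (h' : Path n κ') (m m' : ℤ) :
    ∑ x, amp n κ m x * amp n κ' m' x =
      if (∀ r ≤ n, κ r = κ' r) ∧ m = m' ∧ |m| ≤ (κ n : ℤ) ∧ Even ((κ n : ℤ) - m)
        then 1 else 0 := by
  induction n generalizing m m' with
  | zero =>
    simp only [amp, Finset.univ_unique, Finset.sum_const, Finset.card_singleton, one_smul,
      Nat.le_zero, forall_eq, h.1, h'.1]
    by_cases h1 : m = 0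
    · by_cases h2 : m' = 0
      · simp [h1, h2]
      · simp [h1, h2, Ne.symm h2]
    · simp [h1]
  | succ n ih =>
    rw [sum_bits_succ]
    simp only [amp_snoc]
    have e : ∀ b : Fin 2, ∑ y : Bits n,
        amp n κ (m - twiceZ b) y * cgHalf (κ n) (m - twiceZ b) b (κ (n + 1)) m *
          (amp n κ' (m' - twiceZ b) y * cgHalf (κ' n) (m' - twiceZ b) b (κ' (n + 1)) m') =
        (∑ y : Bits n, amp n κ (m - twiceZ b) y * amp n κ' (m' - twiceZ b) y) *
          (cgHalf (κ n) (m - twiceZ b) b (κ (n + 1)) m *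
            cgHalf (κ' n) (m' - twiceZ b) b (κ' (n + 1)) m') := by
      intro b
      rw [Finset.sum_mul]
      exact Finset.sum_congr rfl fun y _ => by ring
    -- The first n qubits contribute a Kronecker delta; what is left is row orthogonality for the
    -- last coupling.
    simp only [e, ih h.init h'.init]
    have hparity : ∀ b : Fin 2, Even ((κ n : ℤ) - (m - twiceZ b)) ↔ Even ((κ n : ℤ) + 1 - m) := by
      intro b
      fin_cases b <;> simp [twiceZ, Int.even_iff] <;> omega
    have hparity' : Even ((κ (n + 1) : ℤ) - m) ↔ Even ((κ n : ℤ) + 1 - m) := by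
      rcases h.step with h1 | h1
      · rw [h1]; push_cast; rfl
      · rw [h1]; push_cast; simp [parity_simps]
    by_cases hm : m = m'
    · subst hm
      by_cases hκ : ∀ r ≤ n, κ r = κ' r
      · by_cases hp : Even ((κ n : ℤ) + 1 - m)
        · have hs' := h'.step
          rw [← hκ n le_rfl] at hs'
          have := cgHalf_orthogonal h.step hs' hp
          rw [← hκ n le_rfl]
          have e2 : (∀ r ≤ n + 1, κ r = κ' r) ↔ κ (n + 1) = κ' (n + 1) :=
            ⟨fun H => H _ le_rfl, fun H r hr => by
              rcases Nat.lt_or_eq_of_le hr with h1 | h1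
              · exact hκ r (by omega)
              · rw [h1, H]⟩
          simp only [e2, hparity', hp, and_true, true_and]
          rw [← this]
          refine Finset.sum_congr rfl fun b _ => ?_
          -- The range condition from the induction hypothesis is already enforced by the guard in
          -- `cgHalf`, so the indicator can be dropped.
          by_cases hr : |m - twiceZ b| ≤ (κ n : ℤ)
          · rw [if_pos ⟨hκ, hr, (hparity b).2 hp⟩, one_mul]
          · simp [cgHalf, hr]
        · rw [if_neg (fun H => hp (hparity'.1 H.2.2.2))]
          refine Finset.sum_eq_zero fun b _ => ?_
          rw [if_neg (fun H => hp ((hparity b).1 H.2.2.2)), zero_mul]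
      · rw [if_neg (fun H => hκ fun r hr => H.1 r (by omega))]
        refine Finset.sum_eq_zero fun b _ => ?_
        rw [if_neg (fun H => hκ H.1), zero_mul]
    · rw [if_neg (fun H => hm H.2.1)]
      refine Finset.sum_eq_zero fun b _ => ?_
      rw [if_neg (fun H => hm (by linarith [H.2.1])), zero_mul]

/-- Schur kets are complete. -/
lemma eq_zero_of_amp_orthogonal {n : ℕ} (v : Bits n → ℂ)
    (hv : ∀ κ m, Path n κ → ∑ x, (amp n κ m x : ℂ) * v x = 0) : v = 0 := by
  induction n with
  | zero =>
    funext x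
    have := hv (fun _ => 0) 0 ⟨rfl, fun r hr => by omega⟩
    simpa [amp, Unique.eq_default x] using this
  | succ n ih =>
    suffices H : ∀ b : Fin 2, (fun y : Bits n => v (Fin.snoc y b : Bits (n + 1))) = 0 by
      funext x
      have := congrFun (H (x (Fin.last n))) (Fin.init x)
      simpa using this
    intro b
    refine ih _ fun κ p hκ => ?_
    -- The overlaps of the slices of v with a ket on n qubits. Orthogonality to the kets on n + 1
    -- qubits gives linear relations between the slices, which the Clebsch-Gordan matrix inverts.
    set g : Fin 2 → ℤ → ℂ := fun c q =>
      ∑ y : Bits n, (amp n κ q y : ℂ) * v (Fin.snoc y c : Bits (n + 1)) with hg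
    change g b p = 0
    by_cases hrange : |p| ≤ (κ n : ℤ) ∧ Even ((κ n : ℤ) - p)
    swap
    · refine Finset.sum_eq_zero fun y _ => ?_
      have : amp n κ p y = 0 := by
        by_contra h0
        exact hrange ⟨amp_range hκ h0, amp_parity hκ h0⟩
      simp [this]
    obtain ⟨hr, q, hq⟩ := hrange
    set t : ℤ := p + twiceZ b with ht
    have hp : p = t - twiceZ b := by rw [ht]; ring
    have hpar : Even ((κ n : ℤ) + 1 - t) := by
      have hz : twiceZ b = 1 ∨ twiceZ b = -1 := by rw [twiceZ]; split_ifs <;> simp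
      rcases hz with h | h
      · exact ⟨q, by omega⟩
      · exact ⟨q + 1, by omega⟩
    have hB : ∀ B,
        ∑ c : Fin 2, (cgHalf (κ n) (t - twiceZ c) c B t : ℂ) * g c (t - twiceZ c) = 0 := by
      intro B
      by_cases hs : Step (κ n) B
      · have hP : Path (n + 1) (Function.update κ (n + 1) B) := by
          refine ⟨by simp [hκ.1], fun r hr => ?_⟩
          rcases Nat.lt_or_eq_of_le (Nat.lt_succ_iff.mp hr) with h1 | rfl
          · rw [Function.update_of_ne (by omega), Function.update_of_ne (by omega)]
            exact hκ.2 r h1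
          · rw [Function.update_of_ne (by omega), Function.update_self]
            exact hs
        have := hv _ t hP
        rw [sum_bits_succ] at this
        rw [← this]
        refine Finset.sum_congr rfl fun c _ => ?_
        rw [hg, Finset.mul_sum]
        refine Finset.sum_congr rfl fun y _ => ?_
        rw [amp_snoc, Function.update_self, Function.update_of_ne (by omega),
          amp_congr (κ := Function.update κ (n + 1) B) (κ' := κ)
            (fun r hr => Function.update_of_ne (by omega) _ _)]
        push_cast
        ring
      · simp [cgHalf_eq_zero_of_not_step hs]
    -- Column orthogonality, used to recover one slice overlap from the two vanishing combinations
    -- for final spins κ n ± 1.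
    have hc : ∀ c, ((cgHalf (κ n) (t - twiceZ b) b (κ n + 1) t : ℂ) *
        cgHalf (κ n) (t - twiceZ c) c (κ n + 1) t +
        cgHalf (κ n) (t - twiceZ b) b (κ n - 1) t * cgHalf (κ n) (t - twiceZ c) c (κ n - 1) t) =
        if b = c then 1 else 0 := by
      intro c
      have := cgHalf_complete hpar b c (by rwa [← hp])
      split_ifs at this ⊢ <;> exact_mod_cast this
    calc g b p = ∑ c, (if b = c then 1 else 0) * g c (t - twiceZ c) := by simp [← hp]
      _ = (cgHalf (κ n) (t - twiceZ b) b (κ n + 1) t : ℂ) *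
            (∑ c : Fin 2, (cgHalf (κ n) (t - twiceZ c) c (κ n + 1) t : ℂ) * g c (t - twiceZ c)) +
          (cgHalf (κ n) (t - twiceZ b) b (κ n - 1) t : ℂ) *
            (∑ c : Fin 2, (cgHalf (κ n) (t - twiceZ c) c (κ n - 1) t : ℂ) *
              g c (t - twiceZ c)) := by
          simp only [← hc, Finset.mul_sum, ← Finset.sum_add_distrib]
          exact Finset.sum_congr rfl fun c _ => by ring
      _ = 0 := by rw [hB, hB, mul_zero, mul_zero, add_zero]

/-! ### Exchanging the last two qubits -/

/-- The path `κ` with its spin at `r` replaced. -/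
def reroute (κ : ℕ → ℕ) (r a : ℕ) : ℕ → ℕ := Function.update κ r a

lemma reroute_self (κ : ℕ → ℕ) (r a : ℕ) : reroute κ r a r = a := Function.update_self ..

lemma reroute_of_ne (κ : ℕ → ℕ) {r l : ℕ} (h : l ≠ r) (a : ℕ) : reroute κ r a l = κ l :=
  Function.update_of_ne h ..

lemma reroute_eq_self {κ : ℕ → ℕ} {r a : ℕ} (h : κ r = a) : reroute κ r a = κ := by
  rw [reroute, ← h, Function.update_eq_self]

lemma amp_two (n : ℕ) (κ : ℕ → ℕ) (m : ℤ) (y : Bits n) (b c : Fin 2) :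
    amp (n + 2) κ m (Fin.snoc (Fin.snoc y b : Bits (n + 1)) c : Bits (n + 2)) =
      amp n κ (m - twiceZ c - twiceZ b) y * cgPair (κ n) (κ (n + 1)) (κ (n + 2)) m b c := by
  rw [amp_snoc, amp_snoc, cgPair, mul_assoc]

lemma snoc_snoc_comp_swap {n : ℕ} (y : Bits n) (b c : Fin 2) :
    (Fin.snoc (Fin.snoc y b : Bits (n + 1)) c : Bits (n + 2)) ∘
        Equiv.swap (Fin.last n).castSucc (Fin.last (n + 1)) =
      (Fin.snoc (Fin.snoc y c : Bits (n + 1)) b : Bits (n + 2)) := by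
  funext i
  refine Fin.lastCases ?_ (fun i => ?_) i
  · simp [Equiv.swap_apply_right]
  · refine Fin.lastCases ?_ (fun i => ?_) i
    · simp [Equiv.swap_apply_left]
    · have h1 : i.castSucc.castSucc ≠ (Fin.last n).castSucc := by
        simp [Fin.ext_iff]; omega
      have h2 : i.castSucc.castSucc ≠ Fin.last (n + 1) := by
        simp [Fin.ext_iff]; omega
      simp [Equiv.swap_apply_of_ne_of_ne h1 h2]

lemma exists_snoc_snoc {n : ℕ} (x : Bits (n + 2)) :
    ∃ (y : Bits n) (b c : Fin 2), x = (Fin.snoc (Fin.snoc y b : Bits (n + 1)) c : Bits (n + 2)) :=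
  ⟨Fin.init (Fin.init x), Fin.init x (Fin.last n), x (Fin.last (n + 1)), by simp⟩

lemma even_pair_iff (a m : ℤ) (b c : Fin 2) :
    Even (a - (m - twiceZ c - twiceZ b)) ↔ Even (a - m) := by
  fin_cases b <;> fin_cases c <;> simp [twiceZ, parity_simps]

/-- The exchange affects only the pair amplitude, which is that of a triplet here. Range and parity
of the first n qubits may be assumed, since otherwise both sides vanish. -/
lemma amp_swap_of_ne {n : ℕ} {κ : ℕ → ℕ} (h : Path (n + 2) κ) (hne : κ n ≠ κ (n + 2)) (m : ℤ)
    (x : Bits (n + 2)) :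
    amp (n + 2) κ m (x ∘ Equiv.swap (Fin.last n).castSucc (Fin.last (n + 1))) =
      amp (n + 2) κ m x := by
  obtain ⟨y, b, c, rfl⟩ := exists_snoc_snoc x
  rw [snoc_snoc_comp_swap, amp_two, amp_two,
    show m - twiceZ b - twiceZ c = m - twiceZ c - twiceZ b by ring]
  by_cases h0 : amp n κ (m - twiceZ c - twiceZ b) y = 0
  · simp [h0]
  congr 1
  have h1 := amp_range h.init.init h0
  have h2 := (even_pair_iff _ _ _ _).1 (amp_parity h.init.init h0)
  fin_cases b <;> fin_cases c <;> simp [twiceZ] at *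
  · exact (cgPair_comm_of_ne h.init.step h.step hne h1 h2).symm
  · exact cgPair_comm_of_ne h.init.step h.step hne h1 h2

/-- One minus the exchange is twice the singlet projector. Among the two paths returning to the
initial spin it is the rank-one matrix formed from the vector (`singletUp`, `singletDown`), whose
squared norm is 2. -/
lemma amp_swap_of_eq {n : ℕ} {κ : ℕ → ℕ} (h : Path (n + 2) κ) (heq : κ n = κ (n + 2)) (m : ℤ)
    (x : Bits (n + 2)) :
    amp (n + 2) κ m (x ∘ Equiv.swap (Fin.last n).castSucc (Fin.last (n + 1))) =
      amp (n + 2) κ m x - singletAmp (κ n) (κ (n + 1)) *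
        (singletUp (κ n) * amp (n + 2) (reroute κ (n + 1) (κ n + 1)) m x +
          singletDown (κ n) * amp (n + 2) (reroute κ (n + 1) (κ n - 1)) m x) := by
  obtain ⟨y, b, c, rfl⟩ := exists_snoc_snoc x
  have e : ∀ a q, amp n (reroute κ (n + 1) a) q y = amp n κ q y := fun a q =>
    amp_congr (fun r hr => reroute_of_ne _ (by omega) _) _ _
  rw [snoc_snoc_comp_swap, amp_two, amp_two, amp_two, amp_two, e, e,
    show m - twiceZ b - twiceZ c = m - twiceZ c - twiceZ b by ring]
  simp only [reroute_self, reroute_of_ne _ (show n ≠ n + 1 by omega),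
    reroute_of_ne _ (show n + 2 ≠ n + 1 by omega)]
  by_cases h0 : amp n κ (m - twiceZ c - twiceZ b) y = 0
  · simp [h0]
  have h1 := amp_range h.init.init h0
  have h2 := (even_pair_iff _ _ _ _).1 (amp_parity h.init.init h0)
  have := cgPair_sub_swap h.init.step b c h1 h2
  rw [← heq]
  linear_combination (-amp n κ (m - twiceZ c - twiceZ b) y) * this

/-! ### Operators acting on states -/

section act

variable {n : ℕ}

lemma act_apply (A : Op n) (v : Qubits n) (x : Bits n) : act A v x = ∑ y, A x y * v y := rfl

lemma act_add (A : Op n) (v w : Qubits n) : act A (v + w) = act A v + act A w := map_add _ _ _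

lemma act_sub (A : Op n) (v w : Qubits n) : act A (v - w) = act A v - act A w := map_sub _ _ _

lemma act_smul (A : Op n) (c : ℂ) (v : Qubits n) : act A (c • v) = c • act A v := map_smul _ _ _

lemma act_zero (A : Op n) : act A 0 = 0 := map_zero _

lemma add_act (A B : Op n) (v : Qubits n) : act (A + B) v = act A v + act B v := by
  simp [act]

lemma sub_act (A B : Op n) (v : Qubits n) : act (A - B) v = act A v - act B v := by
  simp [act]

lemma smul_act (c : ℂ) (A : Op n) (v : Qubits n) : act (c • A) v = c • act A v := by
  simp [act]

lemma zero_act (v : Qubits n) : act (0 : Op n) v = 0 := by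
  simp [act]

lemma one_act (v : Qubits n) : act (1 : Op n) v = v := by
  ext x
  simp [act_apply, Matrix.one_apply]

lemma mul_act (A B : Op n) (v : Qubits n) : act (A * B) v = act A (act B v) := by
  ext x
  simp only [act_apply, Matrix.mul_apply, Finset.sum_mul, Finset.mul_sum]
  rw [Finset.sum_comm]
  exact Finset.sum_congr rfl fun _ _ => Finset.sum_congr rfl fun _ _ => by ring

lemma sum_act {ι : Type*} (s : Finset ι) (A : ι → Op n) (v : Qubits n) :
    act (∑ i ∈ s, A i) v = ∑ i ∈ s, act (A i) v := by
  simp [act]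

lemma op_ext {A B : Op n} (h : ∀ v, act A v = act B v) : A = B :=
  Matrix.toEuclideanLin.injective (LinearMap.ext h)

end act

/-! ### Exchange operators -/

section swap

variable {n : ℕ}

lemma swapOp_act_apply (a b : Fin n) (v : Qubits n) (x : Bits n) :
    act (swapOp a b) v x = v (x ∘ Equiv.swap a b) := by
  rw [act_apply, Finset.sum_eq_single (x ∘ Equiv.swap a b)]
  · have : x = (x ∘ Equiv.swap a b) ∘ Equiv.swap a b := by
      funext i; simp
    simp [swapOp, ← this]
  · intro y _ hy
    have : ¬ x = y ∘ Equiv.swap a b := by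
      rintro rfl
      apply hy
      funext i
      simp
    simp [swapOp, this]
  · simp

lemma swapOp_comm (a b : Fin n) : swapOp a b = swapOp b a := by
  simp only [swapOp, Equiv.swap_comm]

lemma swapOp_mul_self (a b : Fin n) : swapOp a b * swapOp a b = 1 := by
  refine op_ext fun v => ?_
  ext x
  rw [mul_act, one_act, swapOp_act_apply, swapOp_act_apply]
  refine congrArg v ?_
  funext i
  simp

lemma swapOp_conj (a b c d : Fin n) :
    swapOp a b * swapOp c d * swapOp a b =
      swapOp (Equiv.swap a b c) (Equiv.swap a b d) := by
  refine op_ext fun v => ?_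
  ext x
  simp only [mul_act, swapOp_act_apply]
  refine congrArg v ?_
  rw [Equiv.swap_apply_apply, Equiv.swap_inv]
  rfl

lemma swapOp_conjTranspose (a b : Fin n) : (swapOp a b).conjTranspose = swapOp a b := by
  ext x y
  have : y = x ∘ Equiv.swap a b ↔ x = y ∘ Equiv.swap a b := by
    constructor <;> (rintro rfl; funext i; simp)
  simp [swapOp, Matrix.conjTranspose_apply, this, apply_ite]

/-- Sums of exchanges of qubit `r` with the preceding qubits (Jucys-Murphy elements). -/
def jucysMurphy (r : Fin n) : Op n := ∑ i with i < r, swapOp i r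

lemma jucysMurphy_last (n : ℕ) :
    jucysMurphy (Fin.last n) = ∑ i : Fin n, swapOp i.castSucc (Fin.last n) := by
  simp [jucysMurphy, Finset.sum_filter, Fin.sum_univ_castSucc, Fin.castSucc_lt_last]

lemma jucysMurphy_castSucc (r : Fin n) :
    jucysMurphy r.castSucc = ∑ i with i < r, swapOp i.castSucc r.castSucc := by
  simp [jucysMurphy, Finset.sum_filter, Fin.sum_univ_castSucc, (Fin.le_last _).not_gt]

/-- Conjugation by the exchange of the last two qubits moves every (i, n) to (i, n + 1); the only
missing term is that exchange itself. -/
lemma jucysMurphy_last_succ (n : ℕ) :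
    jucysMurphy (Fin.last (n + 1)) =
      swapOp (Fin.last n).castSucc (Fin.last (n + 1)) * jucysMurphy (Fin.last n).castSucc *
        swapOp (Fin.last n).castSucc (Fin.last (n + 1)) +
      swapOp (Fin.last n).castSucc (Fin.last (n + 1)) := by
  rw [jucysMurphy_last, Fin.sum_univ_castSucc, jucysMurphy_castSucc, Finset.mul_sum,
    Finset.sum_mul, Finset.sum_filter, Fin.sum_univ_castSucc]
  simp only [Fin.castSucc_lt_last, if_true, lt_self_iff_false, if_false, add_zero]
  congr 1
  refine Finset.sum_congr rfl fun i _ => ?_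
  have h1 : i.castSucc.castSucc ≠ (Fin.last n).castSucc := by
    simp [Fin.ext_iff]; omega
  have h2 : i.castSucc.castSucc ≠ Fin.last (n + 1) := by
    simp [Fin.ext_iff]; omega
  rw [swapOp_conj, Equiv.swap_apply_left, Equiv.swap_apply_of_ne_of_ne h1 h2]

end swap

/-! ### Schur kets as eigenvectors of the exchange sums -/

/-- The Schur ket of a path `κ` of doubled spins. -/
def ket (n : ℕ) (κ : ℕ → ℕ) (m : ℤ) : Qubits n := WithLp.toLp 2 fun x => (amp n κ m x : ℂ)

lemma ket_apply (n : ℕ) (κ : ℕ → ℕ) (m : ℤ) (x : Bits n) : ket n κ m x = (amp n κ m x : ℂ) := rfl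

lemma swap_ket_of_ne {n : ℕ} {κ : ℕ → ℕ} (h : Path (n + 2) κ) (hne : κ n ≠ κ (n + 2)) (m : ℤ) :
    act (swapOp (Fin.last n).castSucc (Fin.last (n + 1))) (ket (n + 2) κ m) =
      ket (n + 2) κ m := by
  ext x
  rw [swapOp_act_apply, ket_apply, ket_apply, amp_swap_of_ne h hne]

lemma swap_ket_of_eq {n : ℕ} {κ : ℕ → ℕ} (h : Path (n + 2) κ) (heq : κ n = κ (n + 2)) (m : ℤ) :
    act (swapOp (Fin.last n).castSucc (Fin.last (n + 1))) (ket (n + 2) κ m) =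
      ket (n + 2) κ m - (singletAmp (κ n) (κ (n + 1)) : ℂ) •
        ((singletUp (κ n) : ℂ) • ket (n + 2) (reroute κ (n + 1) (κ n + 1)) m +
          (singletDown (κ n) : ℂ) • ket (n + 2) (reroute κ (n + 1) (κ n - 1)) m) := by
  ext x
  rw [swapOp_act_apply, ket_apply, amp_swap_of_eq h heq]
  simp only [ket_apply, PiLp.sub_apply, PiLp.smul_apply, PiLp.add_apply, smul_eq_mul]
  push_cast
  rfl

/-- The eigenvalue of the exchange sum of qubit `r` on a path with the step `a → b` at `r`. -/
def content (a b r : ℕ) : ℝ := if b = a + 1 then ((a : ℝ) + r) / 2 else ((r : ℝ) - a - 2) / 2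

lemma snoc_comp_swap_castSucc {n : ℕ} (y : Bits n) (b : Fin 2) (i j : Fin n) :
    (Fin.snoc y b : Bits (n + 1)) ∘ Equiv.swap i.castSucc j.castSucc =
      (Fin.snoc (y ∘ Equiv.swap i j) b : Bits (n + 1)) := by
  funext l
  refine Fin.lastCases ?_ (fun l => ?_) l
  · simp [Equiv.swap_apply_of_ne_of_ne (Fin.castSucc_lt_last i).ne' (Fin.castSucc_lt_last j).ne']
  · have : Equiv.swap i.castSucc j.castSucc l.castSucc = (Equiv.swap i j l).castSucc := by
      simp only [Equiv.swap_apply_def, Fin.castSucc_inj]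
      split_ifs <;> rfl
    simp [this]

/-- For a fixed value b of the last qubit, the final Clebsch-Gordan coefficient is a common factor
that the exchanges do not touch. The hypothesis ranges over all m because the remaining qubits have
Z-spin shifted by that of b. -/
lemma jucysMurphy_castSucc_ket {n : ℕ} {κ : ℕ → ℕ} {r : Fin n} {c : ℂ}
    (h : ∀ m, act (jucysMurphy r) (ket n κ m) = c • ket n κ m) (m : ℤ) :
    act (jucysMurphy r.castSucc) (ket (n + 1) κ m) = c • ket (n + 1) κ m := by
  ext x
  obtain ⟨y, b, rfl⟩ : ∃ (y : Bits n) (b : Fin 2), x = (Fin.snoc y b : Bits (n + 1)) :=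
    ⟨Fin.init x, x (Fin.last n), by simp⟩
  have := congrArg (fun v : Qubits n => v y) (h (m - twiceZ b))
  simp only [jucysMurphy, sum_act, WithLp.ofLp_sum, Finset.sum_apply, swapOp_act_apply,
    ket_apply, PiLp.smul_apply, smul_eq_mul] at this
  rw [jucysMurphy_castSucc]
  simp only [sum_act, WithLp.ofLp_sum, Finset.sum_apply, swapOp_act_apply,
    ket_apply, PiLp.smul_apply, smul_eq_mul, snoc_comp_swap_castSucc, amp_snoc]
  push_cast
  rw [← mul_assoc, ← this, Finset.sum_mul]

lemma path_reroute {n : ℕ} {κ : ℕ → ℕ} (h : Path (n + 2) κ) (heq : κ n = κ (n + 2)) {a : ℕ}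
    (ha : Step (κ n) a) : Path (n + 2) (reroute κ (n + 1) a) := by
  refine ⟨by rw [reroute_of_ne _ (by omega), h.1], fun r hr => ?_⟩
  rcases lt_trichotomy r n with h1 | rfl | h1
  · rw [reroute_of_ne _ (by omega), reroute_of_ne _ (by omega)]
    exact h.2 r hr
  · rw [reroute_of_ne _ (by omega), reroute_self]
    exact ha
  · obtain rfl : r = n + 1 := by omega
    rw [reroute_self, reroute_of_ne _ (by omega), ← heq]
    exact ha.symm

/-- A path of spins is a standard Young tableau with at most two rows, and the eigenvalue is the
content (column minus row) of the box added at r. The induction uses `jucysMurphy_last_succ`: a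
triplet step raises the content by 1, and a returning path is settled in the plane of its two
reroutings. -/
lemma jucysMurphy_ket {n : ℕ} {κ : ℕ → ℕ} (h : Path n κ) (r : Fin n) (m : ℤ) :
    act (jucysMurphy r) (ket n κ m) = (content (κ r) (κ (r + 1)) r : ℂ) • ket n κ m := by
  induction n generalizing κ m with
  | zero => exact r.elim0
  | succ n ih =>
    refine Fin.lastCases ?_ (fun r => ?_) r
    swap
    · exact jucysMurphy_castSucc_ket (fun m => ih h.init r m) m
    have hlow : ∀ {κ : ℕ → ℕ} (_ : Path (n + 1) κ) (r : Fin n) (m : ℤ),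
        act (jucysMurphy r.castSucc) (ket (n + 1) κ m) =
          (content (κ r) (κ (r + 1)) r : ℂ) • ket (n + 1) κ m := fun hκ r m =>
      jucysMurphy_castSucc_ket (fun m => ih hκ.init r m) m
    clear ih
    cases n with
    | zero =>
      have h1 : κ 1 = 1 := by
        rcases h.2 0 (by omega) with h2 | h2 <;> simp [h.1] at h2 ⊢; exact h2
      rw [jucysMurphy_last]
      simp [zero_act, content, h.1, h1]
    | succ n =>
      set s : Op (n + 2) := swapOp (Fin.last n).castSucc (Fin.last (n + 1)) with hs
      set X : Op (n + 2) := jucysMurphy (Fin.last n).castSucc with hX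
      have hss : ∀ v, act s (act s v) = v := fun v => by
        rw [← mul_act, hs, swapOp_mul_self, one_act]
      have hXκ : ∀ {κ : ℕ → ℕ} (_ : Path (n + 2) κ), act X (ket (n + 2) κ m) =
          (content (κ n) (κ (n + 1)) n : ℂ) • ket (n + 2) κ m := fun hκ =>
        hlow hκ (Fin.last n) m
      rw [jucysMurphy_last_succ, ← hs, ← hX, add_act, mul_act, mul_act]
      simp only [Fin.val_last]
      by_cases heq : κ n = κ (n + 2)
      · set a := κ n with ha
        -- As s² = 1, the claim is the image under s of this identity, in which X meets only the two
        -- rerouted kets, both eigenvectors by induction.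
        have key : act X (act s (ket (n + 2) κ m)) + ket (n + 2) κ m =
            (content (κ (n + 1)) (κ (n + 2)) (n + 1) : ℂ) • act s (ket (n + 2) κ m) := by
          have hup := hXκ (path_reroute h heq (Or.inl rfl))
          simp only [reroute_self,
            reroute_of_ne _ (show n ≠ n + 1 by omega)] at hup
          have hsu : (singletUp a : ℂ) ^ 2 * (a + 1) = a + 2 := by
            have := singletUp_sq a
            field_simp at this
            exact_mod_cast this
          have hsd : (singletDown a : ℂ) ^ 2 * (a + 1) = a := by
            have := singletDown_sq a
            field_simp at this
            exact_mod_cast this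
          rw [← ha] at hup
          rw [hs, swap_ket_of_eq h heq, act_sub, act_smul, act_add, act_smul, act_smul, hup, hXκ h,
            ← ha, ← heq]
          -- The factor `singletDown a` is kept so that the identity also holds for a = 0, where the
          -- rerouted ket has no admissible path.
          have hdown : (singletDown a : ℂ) • act X (ket (n + 2) (reroute κ (n + 1) (a - 1)) m) =
              (((n : ℝ) - a - 2) / 2 : ℝ) •
                (singletDown a : ℂ) • ket (n + 2) (reroute κ (n + 1) (a - 1)) m := by
            rcases Nat.eq_zero_or_pos a with h0 | h0
            · simp [h0, singletDown]
            · have := hXκ (path_reroute h heq (Or.inr (by omega : κ n = (a - 1) + 1)))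
              simp only [reroute_self,
                reroute_of_ne _ (show n ≠ n + 1 by omega)] at this
              rw [this, content, if_neg (by omega), smul_comm]
              rfl
          rw [hdown]
          rcases h.init.step with hj | hj
          · have e0 : reroute κ (n + 1) (a + 1) = κ := reroute_eq_self hj
            rw [← ha] at hj
            rw [e0, hj]
            ext x
            simp only [content, if_true, singletAmp, PiLp.add_apply, PiLp.sub_apply,
              PiLp.smul_apply, smul_eq_mul, ket_apply, if_neg (show ¬ a = a + 1 + 1 by omega),
              Complex.real_smul]
            push_cast
            linear_combination (-amp (n + 2) κ m x : ℂ) * hsu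
          · have e0 : reroute κ (n + 1) (a - 1) = κ := reroute_eq_self (by omega)
            rw [← ha] at hj
            have e2 : ((κ (n + 1) : ℕ) : ℂ) = a - 1 := by rw [hj]; push_cast; ring
            rw [e0]
            ext x
            simp only [content, if_true, singletAmp, PiLp.add_apply, PiLp.sub_apply,
              PiLp.smul_apply, smul_eq_mul, ket_apply, if_pos hj,
              if_neg (show ¬ κ (n + 1) = a + 1 by omega),
              Complex.real_smul]
            push_cast
            rw [e2]
            linear_combination (amp (n + 2) κ m x : ℂ) * hsd
        rw [← act_add, key, act_smul, hss]
      · have e := swap_ket_of_ne h heq m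
        rw [← hs] at e
        rw [e, hXκ h, act_smul, e]
        have : (content (κ (n + 1)) (κ (n + 1 + 1)) (n + 1) : ℂ) =
            content (κ n) (κ (n + 1)) n + 1 := by
          have : content (κ (n + 1)) (κ (n + 1 + 1)) (n + 1) = content (κ n) (κ (n + 1)) n + 1 := by
            have heq' : ¬ κ n = κ (n + 1 + 1) := heq
            rcases h.init.step with h1 | h1 <;> rcases h.step with h2 | h2
            · rw [content, content, if_pos h2, if_pos h1, h1]; push_cast; ring
            · omega
            · omega
            · rw [content, content, if_neg (by omega), if_neg (by omega), h1]; push_cast; ring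
          rw [this]; push_cast; rfl
        rw [this, add_smul, one_smul]

/-! ### Spin operators -/

section spin

variable {n : ℕ}

lemma onQubit_act_apply (i : Fin n) (P : Matrix (Fin 2) (Fin 2) ℂ) (v : Qubits n) (x : Bits n) :
    act (onQubit i P) v x = ∑ b : Fin 2, P (x i) b * v (Function.update x i b) := by
  have hinj : Function.Injective (fun b : Fin 2 => (Function.update x i b : Bits n)) :=
    Function.update_injective x i
  rw [act_apply]
  symm
  calc ∑ b : Fin 2, P (x i) b * v (Function.update x i b)
      = ∑ b : Fin 2, onQubit i P x (Function.update x i b) * v (Function.update x i b) := by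
        refine Finset.sum_congr rfl fun b _ => ?_
        rw [onQubit, Matrix.of_apply, if_pos, Function.update_self]
        intro l hl
        rw [Function.update_of_ne hl]
    _ = ∑ y ∈ Finset.univ.map ⟨_, hinj⟩, onQubit i P x y * v y := by
        rw [Finset.sum_map]
        rfl
    _ = ∑ y, onQubit i P x y * v y := by
        refine Finset.sum_subset (Finset.subset_univ _) fun y _ hy => ?_
        rw [onQubit, Matrix.of_apply, if_neg, zero_mul]
        intro h
        apply hy
        refine Finset.mem_map.mpr ⟨y i, Finset.mem_univ _, ?_⟩
        funext l
        by_cases hl : l = i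
        · subst hl; simp
        · simp [Function.update_of_ne hl, h l hl]

lemma comp_swap_eq_update (x : Bits n) {i j : Fin n} (h : i ≠ j) :
    x ∘ Equiv.swap i j = Function.update (Function.update x i (x j)) j (x i) := by
  funext l
  by_cases h1 : l = j
  · subst h1; simp
  · by_cases h2 : l = i
    · subst h2; simp [h1]
    · simp [h1, h2, Equiv.swap_apply_of_ne_of_ne h2 h1]

/-- The exchange of two spins in terms of Pauli matrices. -/
lemma sum_pauli_mul {i j : Fin n} (h : i ≠ j) :
    ∑ c : Fin 3, onQubit i (pauli c) * onQubit j (pauli c) = (2 : ℂ) • swapOp i j - 1 := by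
  refine op_ext fun v => ?_
  ext x
  rw [sum_act, sub_act, smul_act, one_act]
  simp only [PiLp.sub_apply, PiLp.smul_apply, swapOp_act_apply, WithLp.ofLp_sum, Finset.sum_apply,
    mul_act, onQubit_act_apply, Function.update_of_ne h.symm, smul_eq_mul]
  have hx : v x = v (Function.update (Function.update x i (x i)) j (x j)) := by simp
  rw [comp_swap_eq_update x h, hx]
  have h2 : ∀ a : Fin 2, a = 0 ∨ a = 1 := by decide
  rcases h2 (x i) with h1 | h1 <;> rcases h2 (x j) with h3 | h3 <;> rw [h1, h3] <;>
    simp [Fin.sum_univ_three, pauli] <;> ring_nf <;> simp <;> ring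

lemma sum_pauli_mul_self (i : Fin n) :
    ∑ c : Fin 3, onQubit i (pauli c) * onQubit i (pauli c) = (3 : ℂ) • (1 : Op n) := by
  refine op_ext fun v => ?_
  ext x
  rw [sum_act, smul_act, one_act]
  simp only [PiLp.smul_apply, WithLp.ofLp_sum, Finset.sum_apply,
    mul_act, onQubit_act_apply, smul_eq_mul, Function.update_self, Function.update_idem]
  have hx : v x = v (Function.update x i (x i)) := by simp
  rw [hx]
  have h2 : ∀ a : Fin 2, a = 0 ∨ a = 1 := by decide
  rcases h2 (x i) with h1 | h1 <;> rw [h1] <;>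
    simp [Fin.sum_univ_three, pauli] <;> ring_nf <;> simp <;> ring

lemma sum_spinComp_mul (a b : Finset (Fin n)) :
    ∑ c : Fin 3, spinComp a c * spinComp b c =
      ∑ i ∈ a, ∑ j ∈ b, (1 / 4 : ℂ) • ∑ c : Fin 3, onQubit i (pauli c) * onQubit j (pauli c) := by
  simp only [spinComp, Finset.sum_mul_sum, Finset.smul_sum]
  rw [Finset.sum_comm]
  refine Finset.sum_congr rfl fun i _ => ?_
  rw [Finset.sum_comm]
  refine Finset.sum_congr rfl fun j _ => Finset.sum_congr rfl fun c _ => ?_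
  rw [smul_mul_smul_comm]
  norm_num

/-- Expand S² of the enlarged set as S_a² + S_r² + 2 S_a·S_r. Here S_r² = 3/4, and by
`sum_pauli_mul` each 2 S_i·S_r equals the exchange minus 1/2. -/
lemma totalSpin_insert {a : Finset (Fin n)} {r : Fin n} (h : r ∉ a) :
    totalSpin (insert r a) =
      totalSpin a + ((3 / 4 : ℂ) - a.card / 2) • (1 : Op n) + ∑ i ∈ a, swapOp i r := by
  have e : ∀ c, spinComp (insert r a) c = spinComp a c + spinComp {r} c := fun c => by
    simp only [spinComp, Finset.sum_insert h, Finset.sum_singleton]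
    rw [add_comm]
  have h1 : ∑ c : Fin 3, spinComp a c * spinComp {r} c =
      (-(a.card : ℂ) / 4) • (1 : Op n) + (1 / 2 : ℂ) • ∑ i ∈ a, swapOp i r := by
    rw [sum_spinComp_mul]
    simp only [Finset.sum_singleton]
    rw [Finset.sum_congr rfl fun i hi => by rw [sum_pauli_mul (ne_of_mem_of_not_mem hi h)]]
    simp only [smul_sub, smul_smul, Finset.sum_sub_distrib, Finset.sum_const, ← Finset.smul_sum]
    rw [← Nat.cast_smul_eq_nsmul ℂ, smul_smul]
    module
  have h2 : ∑ c : Fin 3, spinComp {r} c * spinComp a c =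
      (-(a.card : ℂ) / 4) • (1 : Op n) + (1 / 2 : ℂ) • ∑ i ∈ a, swapOp i r := by
    rw [sum_spinComp_mul]
    simp only [Finset.sum_singleton]
    rw [Finset.sum_congr rfl fun i hi => by
      rw [sum_pauli_mul (ne_of_mem_of_not_mem hi h).symm, swapOp_comm]]
    simp only [smul_sub, smul_smul, Finset.sum_sub_distrib, Finset.sum_const, ← Finset.smul_sum]
    rw [← Nat.cast_smul_eq_nsmul ℂ, smul_smul]
    module
  have h3 : ∑ c : Fin 3, spinComp ({r} : Finset (Fin n)) c * spinComp {r} c =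
      (3 / 4 : ℂ) • (1 : Op n) := by
    rw [sum_spinComp_mul]
    simp only [Finset.sum_singleton, sum_pauli_mul_self, smul_smul]
    norm_num
  simp only [totalSpin, e, mul_add, add_mul, Finset.sum_add_distrib, h1, h2, h3]
  module

lemma firstQubits_zero : firstQubits (0 : Fin (n + 1)) = ∅ := by
  simp [firstQubits]

lemma firstQubits_succ (r : Fin n) :
    firstQubits r.succ = insert r (firstQubits r.castSucc) := by
  ext i
  simp [firstQubits, Fin.ext_iff]
  omega

lemma firstQubits_castSucc (r : Fin n) :
    firstQubits r.castSucc = Finset.univ.filter (· < r) := by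
  ext i
  simp [firstQubits]

lemma card_firstQubits_castSucc (r : Fin n) : (firstQubits r.castSucc).card = r := by
  rw [firstQubits_castSucc, show Finset.univ.filter (· < r) = Finset.Iio r by ext; simp,
    Fin.card_Iio]

/-- Adding qubit r raises S² by 3/4 - r/2 plus a Jucys-Murphy element, and with its content as
eigenvalue this is exactly the increment of (κ/2)(κ/2 + 1) along the step. -/
lemma totalSpin_ket {κ : ℕ → ℕ} (h : Path n κ) (r : Fin (n + 1)) (m : ℤ) :
    act (totalSpin (firstQubits r)) (ket n κ m) =
      ((κ r : ℂ) / 2 * ((κ r : ℂ) / 2 + 1)) • ket n κ m := by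
  induction r using Fin.induction with
  | zero => simp [firstQubits_zero, totalSpin, spinComp, zero_act, h.1]
  | succ r ih =>
    have hr : r ∉ firstQubits r.castSucc := by simp [firstQubits]
    have hj : ∑ i ∈ firstQubits r.castSucc, swapOp i r = jucysMurphy r := by
      rw [firstQubits_castSucc, jucysMurphy]
    rw [firstQubits_succ, totalSpin_insert hr, add_act, add_act, ih, smul_act, one_act, hj,
      jucysMurphy_ket h, card_firstQubits_castSucc, ← add_smul, ← add_smul]
    congr 1
    simp only [Fin.val_castSucc, Fin.val_succ]
    rcases h.2 r r.2 with h1 | h1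
    · rw [content, if_pos h1, h1]; push_cast; ring
    · rw [content, if_neg (by omega), h1]; push_cast; ring

end spin

/-! ### Identification with the Schur states -/

section bridge

variable {n : ℕ}

/-- The path of a tuple of doubled spins. -/
def extend (spin : Fin (n + 1) → ℕ) (r : ℕ) : ℕ := if h : r < n + 1 then spin ⟨r, h⟩ else 0

lemma extend_val (spin : Fin (n + 1) → ℕ) (r : Fin (n + 1)) : extend spin r = spin r := by
  simp [extend, r.2]

lemma extend_update (spin : Fin (n + 1) → ℕ) (r : Fin (n + 1)) (a : ℕ) :
    extend (Function.update spin r a) = reroute (extend spin) r a := by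
  funext l
  by_cases hl : l = r
  · subst hl
    rw [reroute_self, extend_val, Function.update_self]
  · rw [reroute_of_ne _ hl, extend, extend]
    split_ifs with h
    · rw [Function.update_of_ne]
      simpa [Fin.ext_iff] using hl
    · rfl

lemma partialZ_castSucc (x : Bits (n + 1)) (r : Fin (n + 1)) :
    partialZ x r.castSucc = partialZ (Fin.init x : Bits n) r := by
  simp only [partialZ, firstQubits, Finset.sum_filter, Fin.sum_univ_castSucc, Fin.val_castSucc,
    Fin.val_last]
  rw [if_neg (by omega), add_zero]
  rfl

lemma partialZ_last (x : Bits (n + 1)) :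
    partialZ x (Fin.last (n + 1)) =
      partialZ (Fin.init x : Bits n) (Fin.last n) + twiceZ (x (Fin.last n)) := by
  simp [partialZ, firstQubits, Finset.sum_filter, Fin.sum_univ_castSucc, Fin.init]

/-- If the total Z-spin is m, the partial sums in the product are the values that `amp` reaches by
subtracting from m, last qubit first. Otherwise `amp` arrives at its base case with a nonzero value
and vanishes. -/
lemma schurKet_eq_ket (spin : Fin (n + 1) → ℕ) (m : ℤ) :
    schurKet n spin m = ket n (extend spin) m := by
  have key : ∀ (n : ℕ) (spin : Fin (n + 1) → ℕ) (m : ℤ) (x : Bits n),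
      (if partialZ x (Fin.last n) = m then ∏ r : Fin n,
        cgHalf (spin r.castSucc) (partialZ x r.castSucc) (x r) (spin r.succ)
          (partialZ x r.succ) else 0) = amp n (extend spin) m x := by
    intro n
    induction n with
    | zero =>
      intro spin m x
      simp [amp, partialZ, firstQubits, eq_comm]
    | succ n ih =>
      intro spin m x
      have hspin : ∀ r ≤ n, extend (Fin.init spin : Fin (n + 1) → ℕ) r = extend spin r := by
        intro r hr
        simp [extend, Fin.init, Nat.lt_succ_of_le hr, Nat.lt_succ_of_le (Nat.le_succ_of_le hr)]
      rw [amp_succ, ← amp_congr hspin, ← ih, Fin.prod_univ_castSucc, partialZ_last]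
      have e1 : extend spin n = spin (Fin.last n).castSucc := extend_val spin (Fin.last n).castSucc
      have e2 : extend spin (n + 1) = spin (Fin.last n).succ := extend_val spin (Fin.last (n + 1))
      rw [e1, e2]
      by_cases h : partialZ (Fin.init x : Bits n) (Fin.last n) + twiceZ (x (Fin.last n)) = m
      · rw [if_pos h, if_pos (by linarith)]
        congr 1
        · refine Finset.prod_congr rfl fun r _ => ?_
          rw [partialZ_castSucc, ← Fin.castSucc_succ, partialZ_castSucc]
          rfl
        · rw [partialZ_castSucc, Fin.succ_last, partialZ_last, h,
            show partialZ (Fin.init x : Bits n) (Fin.last n) = m - twiceZ (x (Fin.last n)) by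
              linarith]
      · rw [if_neg h, if_neg (fun h' => h (by linarith)), zero_mul]
  ext x
  rw [ket_apply, ← key]
  simp only [schurKet]
  split_ifs <;> simp

lemma zSpin_schurKet (spin : Fin (n + 1) → ℕ) (m : ℤ) :
    act (spinComp Finset.univ 2) (schurKet n spin m) = ((m : ℂ) / 2) • schurKet n spin m := by
  ext x
  have hz : ∀ (i : Fin n) (v : Qubits n),
      act (onQubit i (pauli 2)) v x = (twiceZ (x i) : ℂ) * v x := by
    intro i v
    rw [onQubit_act_apply]
    have hx : v x = v (Function.update x i (x i)) := by simp
    rw [hx]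
    have h2 : ∀ a : Fin 2, a = 0 ∨ a = 1 := by decide
    rcases h2 (x i) with h1 | h1 <;> rw [h1] <;> simp [pauli, twiceZ]
  simp only [spinComp, sum_act, smul_act, WithLp.ofLp_sum, Finset.sum_apply, PiLp.smul_apply, hz,
    smul_eq_mul]
  by_cases h : partialZ x (Fin.last n) = m
  · have : (m : ℂ) = ∑ i, (twiceZ (x i) : ℂ) := by
      rw [← h, partialZ, firstQubits]
      simp
    rw [this, Finset.sum_div, Finset.sum_mul]
    exact Finset.sum_congr rfl fun i _ => by ring
  · simp [schurKet, h]

namespace SchurLabel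

/-- The path of doubled spins of a label. -/
def path (x : SchurLabel n) : ℕ → ℕ := extend x.spin

lemma path_val (x : SchurLabel n) (r : Fin (n + 1)) : x.path r = x.spin r := extend_val _ r

lemma path_isPath (x : SchurLabel n) : Path n x.path := by
  refine ⟨?_, fun r hr => ?_⟩
  · exact (x.path_val 0).trans x.spin_zero
  · have h1 := x.path_val (⟨r, hr⟩ : Fin n).castSucc
    have h2 := x.path_val (⟨r, hr⟩ : Fin n).succ
    simp only [Fin.val_castSucc, Fin.val_succ] at h1 h2
    rw [h1, h2]
    exact x.spin_step ⟨r, hr⟩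

lemma m_range_path (x : SchurLabel n) : |x.m| ≤ (x.path n : ℤ) := by
  have := x.path_val (Fin.last n)
  rw [Fin.val_last] at this
  rw [this]
  exact x.m_range

lemma m_parity_path (x : SchurLabel n) : Even ((x.path n : ℤ) - x.m) := by
  have := x.path_val (Fin.last n)
  rw [Fin.val_last] at this
  rw [this]
  exact x.m_parity

/-- The label of a path. -/
def ofPath (κ : ℕ → ℕ) (m : ℤ) (h : Path n κ) (hr : |m| ≤ (κ n : ℤ))
    (hp : Even ((κ n : ℤ) - m)) : SchurLabel n where
  spin r := κ r
  spin_zero := h.1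
  spin_step r := h.2 r r.2
  m := m
  m_range := hr
  m_parity := hp

lemma path_ofPath (κ : ℕ → ℕ) (m : ℤ) (h : Path n κ) (hr : |m| ≤ (κ n : ℤ))
    (hp : Even ((κ n : ℤ) - m)) {r : ℕ} (hrn : r ≤ n) : (ofPath κ m h hr hp).path r = κ r :=
  path_val _ (⟨r, by omega⟩ : Fin (n + 1))

lemma ext_path {x y : SchurLabel n} (h : ∀ r ≤ n, x.path r = y.path r) (hm : x.m = y.m) :
    x = y := by
  ext r
  · rw [← path_val, ← path_val]
    exact h r (by omega)
  · exact hm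

end SchurLabel

lemma schurState_eq_ket (x : SchurLabel n) : schurState x = ket n x.path x.m :=
  schurKet_eq_ket _ _

lemma ket_congr {κ κ' : ℕ → ℕ} (h : ∀ r ≤ n, κ r = κ' r) (m : ℤ) : ket n κ m = ket n κ' m := by
  ext x
  rw [ket_apply, ket_apply, amp_congr h]

lemma schurState_ofPath (κ : ℕ → ℕ) (m : ℤ) (h : Path n κ) (hr : |m| ≤ (κ n : ℤ))
    (hp : Even ((κ n : ℤ) - m)) : schurState (SchurLabel.ofPath κ m h hr hp) = ket n κ m := by
  rw [schurState_eq_ket]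
  exact ket_congr (fun r hrn => SchurLabel.path_ofPath _ _ _ _ _ hrn) _

lemma schurState_orthonormal : Orthonormal ℂ (schurState (n := n)) := by
  classical
  rw [orthonormal_iff_ite]
  intro x y
  rw [schurState_eq_ket, schurState_eq_ket, PiLp.inner_apply]
  simp only [ket_apply, RCLike.inner_apply, Complex.conj_ofReal]
  have := amp_orthogonal x.path_isPath y.path_isPath x.m y.m
  have e : ((∑ z, amp n x.path x.m z * amp n y.path y.m z : ℝ) : ℂ) =
      ∑ z, (amp n y.path y.m z : ℂ) * (amp n x.path x.m z : ℂ) := by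
    push_cast
    exact Finset.sum_congr rfl fun z _ => mul_comm _ _
  rw [← e, this]
  by_cases h : x = y
  · subst h
    simp [x.m_range_path, x.m_parity_path]
  · rw [if_neg h, if_neg fun H => h (SchurLabel.ext_path H.1 H.2.1), Complex.ofReal_zero]

lemma schurState_span : Submodule.span ℂ (Set.range (schurState (n := n))) = ⊤ := by
  rw [← Submodule.orthogonal_eq_bot_iff, Submodule.eq_bot_iff]
  intro v hv
  have : (v.ofLp : Bits n → ℂ) = 0 := by
    refine eq_zero_of_amp_orthogonal _ fun κ m hκ => ?_
    -- Completeness was proved for all m; values that no label admits give the zero ket.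
    by_cases hr : |m| ≤ (κ n : ℤ) ∧ Even ((κ n : ℤ) - m)
    · have := (Submodule.mem_orthogonal _ _).1 hv _
        (Submodule.subset_span ⟨SchurLabel.ofPath κ m hκ hr.1 hr.2, rfl⟩)
      rw [schurState_ofPath, PiLp.inner_apply] at this
      simp only [ket_apply, RCLike.inner_apply, Complex.conj_ofReal] at this
      rw [← this]
      exact Finset.sum_congr rfl fun z _ => mul_comm _ _
    · refine Finset.sum_eq_zero fun y _ => ?_
      have : amp n κ m y = 0 := by
        by_contra h0
        exact hr ⟨amp_range hκ h0, amp_parity hκ h0⟩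
      simp [this]
  ext x
  exact congrFun this x

lemma schurState_isSpinEigenbasis : IsSpinEigenbasis (schurState (n := n)) := by
  refine ⟨⟨schurState_orthonormal, schurState_span⟩, fun x r => ?_, fun x => zSpin_schurKet _ _⟩
  rw [schurState_eq_ket, totalSpin_ket x.path_isPath, x.path_val]

end bridge

/-! ### Functional calculus on eigenvectors -/

/-- Diagonalize A = UDU* and put w = U*v. Then Dw = tw says that the diagonal entry is t wherever w
is nonzero, so f(D)w = f(t)w. Continuity of f is not needed in finite dimension. -/
lemma act_cfc {n : ℕ} {A : Op n} (hA : A.IsHermitian) (f : ℝ → ℝ) {v : Qubits n} {t : ℝ}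
    (hv : act A v = (t : ℂ) • v) : act (cfc f A) v = (f t : ℂ) • v := by
  set U : Op n := (hA.eigenvectorUnitary : Matrix (Bits n) (Bits n) ℂ)
  have hUU : star U * U = 1 := Unitary.coe_star_mul_self _
  have hUU' : U * star U = 1 := Unitary.coe_mul_star_self _
  have hspec : A = U * Matrix.diagonal (RCLike.ofReal ∘ hA.eigenvalues) * star U := by
    conv_lhs => rw [hA.spectral_theorem]
    rfl
  have hcfc : cfc f A = U * Matrix.diagonal (RCLike.ofReal ∘ f ∘ hA.eigenvalues) * star U := by
    rw [hA.cfc_eq]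
    rfl
  set w := act (star U) v with hw
  have hvw : act U w = v := by rw [hw, ← mul_act, hUU', one_act]
  have hdiag : ∀ (d : Bits n → ℂ) (x : Bits n), act (Matrix.diagonal d) w x = d x * w x := by
    intro d x
    rw [act_apply, Finset.sum_eq_single x]
    · simp
    · intro y _ hy
      rw [Matrix.diagonal_apply_ne' _ hy, zero_mul]
    · simp
  have h1 : act (Matrix.diagonal (RCLike.ofReal ∘ hA.eigenvalues)) w = (t : ℂ) • w := by
    have := congrArg (act (star U)) hv
    conv_lhs at this => rw [hspec]
    rw [mul_act, mul_act, ← mul_act (star U) U, hUU, one_act, act_smul] at this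
    exact this
  have h2 : act (Matrix.diagonal (RCLike.ofReal ∘ f ∘ hA.eigenvalues)) w = (f t : ℂ) • w := by
    ext x
    have := congrArg (fun u : Qubits n => u x) h1
    simp only [hdiag, PiLp.smul_apply, smul_eq_mul, Function.comp_apply] at this ⊢
    by_cases hx : w x = 0
    · simp [hx]
    · have : hA.eigenvalues x = t :=
        Complex.ofReal_injective (mul_right_cancel₀ hx this)
      rw [this]
      rfl
  rw [hcfc, mul_act, mul_act, ← hw, h2, act_smul, hvw]

/-! ### The square-root measurement -/

/-- The singlet projector is (1 - SWAP)/2, written in matrix entries. -/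
lemma singlet_mul_star (a b c d : Fin 2) :
    singlet a b * star (singlet c d) =
      (1 / 2 : ℂ) * ((if a = c ∧ b = d then 1 else 0) - (if a = d ∧ b = c then 1 else 0)) := by
  have h : (((√2 : ℝ) : ℂ))⁻¹ * ((√2 : ℝ) : ℂ)⁻¹ = 1 / 2 := by
    rw [← mul_inv]
    norm_cast
    rw [Real.mul_self_sqrt (by norm_num)]
    norm_num
  fin_cases a <;> fin_cases b <;> fin_cases c <;> fin_cases d <;> simp [singlet] <;>
    simpa using h

lemma sigma_eq (N : ℕ) (hN : 1 ≤ N) (i : Fin N) :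
    sigma N i = ((1 : ℂ) / 2 ^ N) • (1 - swapOp i.castSucc (Fin.last N)) := by
  have hne : i.castSucc ≠ Fin.last N := (Fin.castSucc_lt_last i).ne
  obtain ⟨M, rfl⟩ : ∃ M, N = M + 1 := ⟨N - 1, by omega⟩
  ext x y
  simp only [sigma, Matrix.smul_apply, Matrix.of_apply, Matrix.sub_apply, Matrix.one_apply,
    swapOp, smul_eq_mul, singlet_mul_star, Nat.add_sub_cancel]
  have e1 : x = y ↔ (∀ l, l ≠ i.castSucc → l ≠ Fin.last (M + 1) → x l = y l) ∧
      x i.castSucc = y i.castSucc ∧ x (Fin.last (M + 1)) = y (Fin.last (M + 1)) := by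
    constructor
    · rintro rfl; simp
    · rintro ⟨h1, h2, h3⟩
      funext l
      by_cases hl : l = i.castSucc
      · rw [hl, h2]
      · by_cases hl' : l = Fin.last (M + 1)
        · rw [hl', h3]
        · exact h1 l hl hl'
  have e2 : x = y ∘ Equiv.swap i.castSucc (Fin.last (M + 1)) ↔
      (∀ l, l ≠ i.castSucc → l ≠ Fin.last (M + 1) → x l = y l) ∧
      x i.castSucc = y (Fin.last (M + 1)) ∧ x (Fin.last (M + 1)) = y i.castSucc := by
    constructor
    · rintro rfl
      refine ⟨fun l h1 h2 => ?_, ?_, ?_⟩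
      · simp [Equiv.swap_apply_of_ne_of_ne h1 h2]
      · simp
      · simp
    · rintro ⟨h1, h2, h3⟩
      funext l
      by_cases hl : l = i.castSucc
      · rw [hl, h2]; simp
      · by_cases hl' : l = Fin.last (M + 1)
        · rw [hl', h3]; simp
        · rw [h1 l hl hl']; simp [Equiv.swap_apply_of_ne_of_ne hl hl']
  by_cases hC : ∀ l, l ≠ i.castSucc → l ≠ Fin.last (M + 1) → x l = y l
  · rw [if_pos hC]
    have e1' := e1.trans (and_iff_right hC)
    have e2' := e2.trans (and_iff_right hC)
    simp only [e1', e2']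
    rw [pow_succ]
    ring
  · rw [if_neg hC, if_neg (fun h => hC (e1.1 h).1), if_neg (fun h => hC (e2.1 h).1)]
    simp

/-- This places ρ among the operators that `jucysMurphy_ket` diagonalizes. -/
lemma rho_eq (N : ℕ) (hN : 1 ≤ N) :
    rho N = ((1 : ℂ) / 2 ^ N) • ((N : ℂ) • 1 - jucysMurphy (Fin.last N)) := by
  rw [rho, Finset.sum_congr rfl fun i _ => sigma_eq N hN i, ← Finset.smul_sum,
    Finset.sum_sub_distrib, jucysMurphy_last]
  simp [Nat.cast_smul_eq_nsmul]

lemma sigma_isHermitian (N : ℕ) (hN : 1 ≤ N) (i : Fin N) : (sigma N i).IsHermitian := by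
  rw [sigma_eq N hN, Matrix.IsHermitian, Matrix.conjTranspose_smul, Matrix.conjTranspose_sub,
    Matrix.conjTranspose_one, swapOp_conjTranspose]
  simp

lemma rho_isHermitian (N : ℕ) (hN : 1 ≤ N) : (rho N).IsHermitian := by
  rw [Matrix.IsHermitian, rho, Matrix.conjTranspose_sum]
  exact Finset.sum_congr rfl fun i _ => sigma_isHermitian N hN i

/-- The eigenvalue of `ρ` on Schur kets with the last step `j → s`. -/
def rhoEig (N j s : ℕ) : ℝ := 1 / 2 ^ N * ((N : ℝ) - content j s N)

lemma rho_ket {N : ℕ} (hN : 1 ≤ N) {κ : ℕ → ℕ} (h : Path (N + 1) κ) (m : ℤ) :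
    act (rho N) (ket (N + 1) κ m) = (rhoEig N (κ N) (κ (N + 1)) : ℂ) • ket (N + 1) κ m := by
  rw [rho_eq N hN, smul_act, sub_act, smul_act, one_act, jucysMurphy_ket h, ← sub_smul, smul_smul,
    rhoEig]
  push_cast
  rfl

/-- The value is λ⁻ at the spin j/2 of the ports; `rhoEig_down` likewise gives λ⁺ at spin (s + 1)/2.
-/
lemma rhoEig_up (N j : ℕ) : rhoEig N j (j + 1) = 1 / 2 ^ N * (((N : ℝ) - j) / 2) := by
  rw [rhoEig, content, if_pos rfl]
  ring

lemma rhoEig_down (N s : ℕ) : rhoEig N (s + 1) s = 1 / 2 ^ N * (((N : ℝ) + s + 3) / 2) := by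
  rw [rhoEig, content, if_neg (by omega)]
  push_cast
  ring

/-- Maximal spin forces the ports to have maximal spin too. With `rhoEig_pos` this identifies the
kernel of ρ, where the convention for ρ^{-1/2} matters. -/
lemma rhoEig_eq_zero {N : ℕ} {κ : ℕ → ℕ} (h : Path (N + 1) κ) (hs : κ (N + 1) = N + 1) :
    rhoEig N (κ N) (κ (N + 1)) = 0 := by
  have := h.init.le
  rcases h.step with h1 | h1
  · rw [h1, rhoEig_up, show κ N = N by omega]; simp
  · omega

lemma rhoEig_pos {N : ℕ} {κ : ℕ → ℕ} (h : Path (N + 1) κ) (hs : κ (N + 1) ≠ N + 1) :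
    0 < rhoEig N (κ N) (κ (N + 1)) := by
  have := h.init.le
  rcases h.step with h1 | h1
  · rw [h1, rhoEig_up]
    have : (κ N : ℝ) < N := by
      have : κ N < N := by omega
      exact_mod_cast this
    have : 0 < (N : ℝ) - κ N := by linarith
    positivity
  · rw [h1, rhoEig_down]
    positivity

lemma rhoInvSqrt_ket {N : ℕ} (hN : 1 ≤ N) {κ : ℕ → ℕ} (h : Path (N + 1) κ) (m : ℤ) :
    act (rhoInvSqrt N) (ket (N + 1) κ m) =
      (((√(rhoEig N (κ N) (κ (N + 1))))⁻¹ : ℝ) : ℂ) • ket (N + 1) κ m :=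
  act_cfc (rho_isHermitian N hN) _ (rho_ket hN h m)

lemma excess_eq (N : ℕ) :
    excess N = ((1 : ℂ) / N) • (1 - rhoInvSqrt N * rho N * rhoInvSqrt N) := by
  rw [excess, rho, Finset.mul_sum, Finset.sum_mul]

/-- The product ρ^{-1/2} ρ ρ^{-1/2} is the projector on the support of ρ, so the excess lives on the
kernel alone. -/
lemma excess_ket {N : ℕ} (hN : 1 ≤ N) {κ : ℕ → ℕ} (h : Path (N + 1) κ) (m : ℤ) :
    act (excess N) (ket (N + 1) κ m) =
      (((if κ (N + 1) = N + 1 then 1 / N else 0 : ℝ)) : ℂ) • ket (N + 1) κ m := by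
  rw [excess_eq, smul_act, sub_act, one_act, mul_act, mul_act, rhoInvSqrt_ket hN h, act_smul,
    rho_ket hN h, act_smul, act_smul, rhoInvSqrt_ket hN h]
  split_ifs with hs
  · rw [rhoEig_eq_zero h hs]
    simp
  · have hpos := rhoEig_pos h hs
    set e := rhoEig N (κ N) (κ (N + 1))
    have : (((√e)⁻¹ : ℝ) : ℂ) * (e : ℂ) * (((√e)⁻¹ : ℝ) : ℂ) = 1 := by
      norm_cast
      have h1 := Real.mul_self_sqrt hpos.le
      have h2 : √e ≠ 0 := (Real.sqrt_pos.mpr hpos).ne'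
      field_simp
      rw [sq]
      linarith
    rw [smul_smul, smul_smul, this]
    simp

/-! ### The element `Π_N` on Schur kets and the coefficients α, β -/

section lastPort

variable {M : ℕ}

lemma sigma_last_ket_of_ne {κ : ℕ → ℕ} (h : Path (M + 2) κ) (hne : κ M ≠ κ (M + 2)) (m : ℤ) :
    act (sigma (M + 1) (Fin.last M)) (ket (M + 2) κ m) = 0 := by
  rw [sigma_eq _ (by omega), smul_act, sub_act, one_act, swap_ket_of_ne h hne, sub_self, smul_zero]

lemma sigma_last_ket_of_eq {κ : ℕ → ℕ} (h : Path (M + 2) κ) (heq : κ M = κ (M + 2)) (m : ℤ) :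
    act (sigma (M + 1) (Fin.last M)) (ket (M + 2) κ m) =
      ((1 / 2 ^ (M + 1) * singletAmp (κ M) (κ (M + 1)) : ℝ) : ℂ) •
        ((singletUp (κ M) : ℂ) • ket (M + 2) (reroute κ (M + 1) (κ M + 1)) m +
          (singletDown (κ M) : ℂ) • ket (M + 2) (reroute κ (M + 1) (κ M - 1)) m) := by
  rw [sigma_eq _ (by omega), smul_act, sub_act, one_act, swap_ket_of_eq h heq, sub_sub_cancel,
    smul_smul]
  push_cast
  rfl

lemma povm_ket_of_ne {κ : ℕ → ℕ} (h : Path (M + 2) κ) (hne : κ M ≠ κ (M + 2)) (m : ℤ) :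
    act (povm (M + 1) (Fin.last M)) (ket (M + 2) κ m) =
      ((if κ (M + 2) = M + 2 then 1 / ((M + 1 : ℕ) : ℝ) else 0 : ℝ) : ℂ) • ket (M + 2) κ m := by
  rw [povm, add_act, excess_ket (by omega) h, mul_act, mul_act, rhoInvSqrt_ket (by omega) h,
    act_smul, sigma_last_ket_of_ne h hne, smul_zero, act_zero, zero_add]

/-- Up to a common sign, α and β are the singlet amplitudes times 2^{-N/2} and the eigenvalue of
ρ^{-1/2} on the path through a - 1 or a + 1. The sign cancels in Π_N, which is quadratic in them.
The bound on a keeps λ⁻ positive. -/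
lemma alpha_eq (a : ℕ) (ha : 1 ≤ a) (haN : a ≤ M) :
    alpha (M + 1) ((a : ℝ) / 2) =
      -(√(1 / 2 ^ (M + 1)) * singletDown a * (√(rhoEig (M + 1) (a - 1) a))⁻¹) := by
  obtain ⟨b, rfl⟩ : ∃ b, a = b + 1 := ⟨a - 1, by omega⟩
  have hb : (b : ℝ) + 1 ≤ M := by exact_mod_cast haN
  rw [Nat.add_sub_cancel, rhoEig_up, alpha, lamMinus, singletDown, Nat.add_sub_cancel,
    Real.sqrt_mul (show (0 : ℝ) ≤ 1 / 2 ^ (M + 1) by positivity) ((((M + 1 : ℕ) : ℝ) - b) / 2)]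
  have hw : √(1 / 2 ^ (M + 1) : ℝ) ≠ 0 := by positivity
  have hd : 0 < ((M + 1 : ℕ) : ℝ) - b := by push_cast; linarith
  rw [mul_inv, mul_neg, neg_mul, neg_neg, mul_comm (√(1 / 2 ^ (M + 1))), mul_assoc,
    mul_inv_cancel_left₀ hw, ← Real.sqrt_div (by positivity), ← Real.sqrt_div (by positivity),
    ← Real.sqrt_inv, ← Real.sqrt_mul (by positivity)]
  congr 1
  have : (2 : ℝ) ^ M * (1 / 2 ^ (M + 1) * (((M + 1 : ℕ) : ℝ) / 2 - (((b + 1 : ℕ) : ℝ) / 2 - 1 / 2)))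
      = (((M + 1 : ℕ) : ℝ) - b) / 4 := by
    rw [pow_succ]
    field_simp
    push_cast
    ring
  rw [this]
  push_cast at *
  field_simp
  ring

lemma beta_eq (a : ℕ) :
    beta (M + 1) ((a : ℝ) / 2) =
      -(√(1 / 2 ^ (M + 1)) * singletUp a * (√(rhoEig (M + 1) (a + 1) a))⁻¹) := by
  rw [rhoEig_down, beta, lamPlus, singletUp, Nat.add_sub_cancel,
    Real.sqrt_mul (show (0 : ℝ) ≤ 1 / 2 ^ (M + 1) by positivity) ((((M + 1 : ℕ) : ℝ) + a + 3) / 2)]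
  have hw : √(1 / 2 ^ (M + 1) : ℝ) ≠ 0 := by positivity
  rw [mul_inv, mul_comm (√(1 / 2 ^ (M + 1))), mul_assoc, neg_div,
    mul_inv_cancel_left₀ hw, ← Real.sqrt_div (by positivity), ← Real.sqrt_div (by positivity),
    ← Real.sqrt_inv, ← Real.sqrt_mul (by positivity)]
  congr 2
  have : (2 : ℝ) ^ M * (1 / 2 ^ (M + 1) * (((M + 1 : ℕ) : ℝ) / 2 + ((a : ℝ) / 2 + 1 / 2) + 1))
      = (((M + 1 : ℕ) : ℝ) + a + 3) / 4 := by
    rw [pow_succ]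
    field_simp
    push_cast
    ring
  rw [this]
  field_simp
  ring

lemma alpha_zero (N : ℕ) : alpha N 0 = 0 := by simp [alpha]

lemma alpha_sq (N : ℕ) (hN : 1 ≤ N) {s : ℝ} (h0 : 0 ≤ s) (hs : s < ((N : ℝ) + 1) / 2) :
    alpha N s ^ 2 = 4 * s / ((2 * s + 1) * (N + 1 - 2 * s)) := by
  obtain ⟨M, rfl⟩ : ∃ M, N = M + 1 := ⟨N - 1, by omega⟩
  push_cast at *
  have hd : 0 < (M : ℝ) + 1 + 1 - 2 * s := by linarith
  have : (2 : ℝ) ^ M * (1 / 2 ^ (M + 1) * (((M : ℝ) + 1) / 2 - (s - 1 / 2))) =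
      ((M : ℝ) + 1 + 1 - 2 * s) / 4 := by
    rw [pow_succ]
    field_simp
    ring
  rw [alpha, lamMinus, div_pow, Nat.add_sub_cancel]
  push_cast
  rw [this, Real.sq_sqrt (by positivity), Real.sq_sqrt (by positivity)]
  field_simp

lemma beta_sq (N : ℕ) (hN : 1 ≤ N) {s : ℝ} (h0 : 0 ≤ s) :
    beta N s ^ 2 = 4 * (s + 1) / ((2 * s + 1) * (N + 3 + 2 * s)) := by
  obtain ⟨M, rfl⟩ : ∃ M, N = M + 1 := ⟨N - 1, by omega⟩
  have : (2 : ℝ) ^ M * (1 / 2 ^ (M + 1) * (((M : ℝ) + 1) / 2 + (s + 1 / 2) + 1)) =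
      ((M : ℝ) + 1 + 3 + 2 * s) / 4 := by
    rw [pow_succ]
    field_simp
    ring
  rw [beta, lamPlus, div_pow, Nat.add_sub_cancel, neg_sq]
  push_cast
  rw [this, Real.sq_sqrt (by positivity), Real.sq_sqrt (by positivity)]
  field_simp

/-- Over a common denominator the factor 2s + 1 cancels, because s(N + 3 + 2s) + (s + 1)(N + 1 - 2s)
= (2s + 1)(N + 1). -/
lemma alpha_sq_add_beta_sq (N : ℕ) (hN : 1 ≤ N) {s : ℝ} (h0 : 0 ≤ s)
    (hs : s < ((N : ℝ) + 1) / 2) :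
    alpha N s ^ 2 + beta N s ^ 2 =
      4 * ((N : ℝ) + 1) / (((N : ℝ) + 1 - 2 * s) * ((N : ℝ) + 3 + 2 * s)) := by
  rw [alpha_sq N hN h0 hs, beta_sq N hN h0]
  have hd : (N : ℝ) + 1 - 2 * s ≠ 0 := by
    have : 0 < (N : ℝ) + 1 - 2 * s := by linarith
    exact this.ne'
  have hd' : (N : ℝ) + 3 + 2 * s ≠ 0 := by positivity
  have hd'' : 2 * s + 1 ≠ 0 := by positivity
  rw [div_add_div _ _ (mul_ne_zero hd'' hd) (mul_ne_zero hd'' hd'),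
    div_eq_div_iff (mul_ne_zero (mul_ne_zero hd'' hd) (mul_ne_zero hd'' hd')) (mul_ne_zero hd hd')]
  ring

/-- `Π_N` on Schur kets with `k = s`. -/
lemma povm_ket_of_eq {κ : ℕ → ℕ} (h : Path (M + 2) κ) (heq : κ M = κ (M + 2)) (m : ℤ) :
    act (povm (M + 1) (Fin.last M)) (ket (M + 2) κ m) =
      ((if κ (M + 1) = κ M + 1 then beta (M + 1) ((κ M : ℝ) / 2)
        else alpha (M + 1) ((κ M : ℝ) / 2) : ℝ) : ℂ) •
        ((beta (M + 1) ((κ M : ℝ) / 2) : ℂ) • ket (M + 2) (reroute κ (M + 1) (κ M + 1)) m +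
          (alpha (M + 1) ((κ M : ℝ) / 2) : ℂ) • ket (M + 2) (reroute κ (M + 1) (κ M - 1)) m) := by
  have hle := h.init.init.le
  have e1 : κ (M + 1 + 1) = κ M := heq.symm
  set a := κ M with ha
  -- The prefactor 2^{-N} of σ is split as w · w: one w enters the scalar coefficient, the other the
  -- coefficients of the vector.
  set w : ℝ := √(1 / 2 ^ (M + 1)) with hw
  have hww : (1 / 2 ^ (M + 1) : ℝ) = w * w := (Real.mul_self_sqrt (by positivity)).symm
  rw [povm, add_act, excess_ket (by omega) h, if_neg (by omega), Complex.ofReal_zero, zero_smul,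
    add_zero, mul_act, mul_act, rhoInvSqrt_ket (by omega) h, act_smul,
    sigma_last_ket_of_eq h heq, act_smul, act_smul, act_add, act_smul, act_smul]
  have hup : act (rhoInvSqrt (M + 1)) (ket (M + 2) (reroute κ (M + 1) (a + 1)) m) =
      (((√(rhoEig (M + 1) (a + 1) a))⁻¹ : ℝ) : ℂ) • ket (M + 2) (reroute κ (M + 1) (a + 1)) m := by
    have := rhoInvSqrt_ket (by omega) (path_reroute h heq (Or.inl rfl)) m
    rwa [reroute_self, reroute_of_ne _ (by omega), e1] at this
  rw [← ha, hup]
  have hb := beta_eq (M := M) a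
  -- For a = 0 the path through a - 1 is not admissible, so `rhoInvSqrt_ket` does not apply to it,
  -- but its coefficient is zero.
  rcases Nat.eq_zero_or_pos a with h0 | h0
  · have hj : κ (M + 1) = a + 1 := by
      rcases h.init.step with h1 | h1
      · exact h1
      · omega
    rw [h0] at hb
    simp only [Nat.cast_zero, zero_div, zero_add] at hb
    rw [e1, hj, if_pos rfl, hww]
    simp only [h0, singletAmp, if_true, singletDown, Nat.cast_zero, Real.sqrt_zero, zero_div,
      neg_zero, Complex.ofReal_zero, zero_smul, add_zero, alpha_zero, smul_smul, zero_add, hb]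
    congr 1
    push_cast
    ring
  · have hdown : act (rhoInvSqrt (M + 1)) (ket (M + 2) (reroute κ (M + 1) (a - 1)) m) =
        (((√(rhoEig (M + 1) (a - 1) a))⁻¹ : ℝ) : ℂ) •
          ket (M + 2) (reroute κ (M + 1) (a - 1)) m := by
      have := rhoInvSqrt_ket (by omega)
        (path_reroute h heq (Or.inr (by omega : κ M = (a - 1) + 1))) m
      rwa [reroute_self, reroute_of_ne _ (by omega), e1] at this
    have hal := alpha_eq a h0 hle
    rw [hdown, hww, smul_smul, smul_smul, smul_smul, smul_add, smul_add, smul_smul, smul_smul,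
      smul_smul, smul_smul]
    rcases h.init.step with hj | hj
    · rw [← ha] at hj
      rw [e1, hj, if_pos rfl, singletAmp, if_pos rfl, hb, hal, ← hw]
      congr 2
      · push_cast; ring
      · push_cast; ring
    · rw [← ha] at hj
      rw [e1, show κ (M + 1) = a - 1 by omega, if_neg (by omega), singletAmp, if_neg (by omega),
        hb, hal, ← hw]
      congr 2
      · push_cast; ring
      · push_cast; ring

end lastPort

/-! ### Rotating pairs of an orthonormal family -/

section rotate

variable {ι E : Type*} [NormedAddCommGroup E] [InnerProductSpace ℂ E]

/-- The involution splits the family into pairs, on which (p, q; -q, p) is a rotation, and fixed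
points, where q = -q = 0 and p = ±1. -/
lemma orthonormal_rotate {v : ι → E} (hv : Orthonormal ℂ v) {f : ι → ι}
    (hf : Function.Involutive f) {p q : ι → ℝ} (hp : ∀ i, p (f i) = p i)
    (hq : ∀ i, q (f i) = -q i) (h1 : ∀ i, p i ^ 2 + q i ^ 2 = 1) :
    Orthonormal ℂ fun i => (p i : ℂ) • v i + (q i : ℂ) • v (f i) := by
  classical
  rw [orthonormal_iff_ite] at hv ⊢
  intro i j
  simp only [inner_add_left, inner_add_right, inner_smul_left, inner_smul_right, hv,
    Complex.conj_ofReal, hf.injective.eq_iff]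
  have hfj : f i = j ↔ i = f j := ⟨fun h => by rw [← h, hf i], fun h => by rw [h, hf j]⟩
  simp only [hfj]
  have hone : (p i : ℂ) * p i + q i * q i = 1 := by
    have := h1 i
    norm_cast
    linarith
  by_cases hij : i = j
  · subst hij
    by_cases hii : i = f i
    · have : q i = 0 := by
        have := hq i
        rw [← hii] at this
        linarith
      simp only [this, if_true] at hone ⊢
      simpa using hone
    · simp only [hii, if_true, if_false, mul_one, mul_zero, add_zero, zero_add]
      exact hone
  · by_cases hij' : i = f j
    · have hpi : p i = p j := by rw [hij', hp]
      have hqi : q i = -q j := by rw [hij', hq]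
      simp only [if_neg hij, if_pos hij', hpi, hqi]
      push_cast
      ring
    · simp [hij, hij']

/-- The inverse rotation recovers each v i from the rotated vectors at i and f i. -/
lemma span_rotate {v : ι → E} {f : ι → ι} (hf : Function.Involutive f) {p q : ι → ℝ}
    (hp : ∀ i, p (f i) = p i) (hq : ∀ i, q (f i) = -q i) (h1 : ∀ i, p i ^ 2 + q i ^ 2 = 1)
    (hv : Submodule.span ℂ (Set.range v) = ⊤) :
    Submodule.span ℂ (Set.range fun i => (p i : ℂ) • v i + (q i : ℂ) • v (f i)) = ⊤ := by
  rw [eq_top_iff, ← hv, Submodule.span_le]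
  rintro _ ⟨i, rfl⟩
  set w : ι → E := fun i => (p i : ℂ) • v i + (q i : ℂ) • v (f i) with hw
  have hone : (p i : ℂ) * p i + q i * q i = 1 := by
    have := h1 i
    norm_cast
    linarith
  have : v i = (p i : ℂ) • w i - (q i : ℂ) • w (f i) := by
    simp only [hw, hp, hq, hf i]
    push_cast
    have e : v i = ((p i : ℂ) * p i + q i * q i) • v i := by rw [hone, one_smul]
    conv_lhs => rw [e]
    module
  rw [this]
  exact Submodule.sub_mem _ (Submodule.smul_mem _ _ (Submodule.subset_span ⟨i, rfl⟩))
    (Submodule.smul_mem _ _ (Submodule.subset_span ⟨f i, rfl⟩))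

end rotate

/-! ### The rotated basis -/

namespace SchurLabel

variable {M : ℕ}

lemma twoK_eq (x : SchurLabel (M + 1 + 1)) : x.twoK = x.path M :=
  (x.path_val (⟨M, by omega⟩ : Fin (M + 1 + 1 + 1))).symm

lemma twoJ_eq (x : SchurLabel (M + 1 + 1)) : x.twoJ = x.path (M + 1) :=
  (x.path_val (⟨M + 1, by omega⟩ : Fin (M + 1 + 1 + 1))).symm

lemma twoS_eq (x : SchurLabel (M + 1 + 1)) : x.twoS = x.path (M + 2) :=
  (x.path_val (Fin.last (M + 1 + 1))).symm

lemma ketWithJ_eq (x : SchurLabel (M + 1 + 1)) (a : ℕ) :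
    x.ketWithJ a = ket (M + 2) (reroute x.path (M + 1) a) x.m := by
  rw [ketWithJ, schurKet_eq_ket, extend_update]
  rfl

lemma s_nonneg (x : SchurLabel (M + 1)) : 0 ≤ x.s := by
  rw [s]; positivity

lemma rotNorm_pos (x : SchurLabel (M + 1 + 1)) : 0 < x.rotNorm := by
  rw [rotNorm, Real.sqrt_pos]
  have h := beta_sq (M + 1) (by omega) x.s_nonneg
  have : 0 < beta (M + 1) x.s ^ 2 := by
    rw [h]
    have := x.s_nonneg
    positivity
  positivity

lemma lowerKet_eq_zero (x : SchurLabel (M + 1 + 1)) (hs : x.twoS = 0) :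
    x.lowerKet = 0 := by
  rw [lowerKet, ketWithJ_eq]
  ext y
  rw [ket_apply, amp_succ, reroute_self, reroute_of_ne _ (by omega),
    cgHalf_eq_zero_of_not_step]
  · simp
  · have : x.path (M + 1 + 1) = 0 := by rw [← hs]; exact x.twoS_eq.symm
    rw [this, hs]
    simp [Step]

/-- Together with `povm_lowerKet`: both kets go to multiples, by β and α, of the same vector β·upper
+ α·lower, so Π_N has rank one on their span. -/
lemma povm_upperKet (x : SchurLabel (M + 1 + 1)) (hk : x.twoK = x.twoS) :
    act (povm (M + 1) (Fin.last M)) x.upperKet =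
      (beta (M + 1) x.s : ℂ) •
        ((beta (M + 1) x.s : ℂ) • x.upperKet + (alpha (M + 1) x.s : ℂ) • x.lowerKet) := by
  have heq : x.path M = x.path (M + 2) := by rw [← twoK_eq, ← twoS_eq, hk]
  have hs : x.s = (x.path M : ℝ) / 2 := by rw [s, ← hk, twoK_eq]
  have := povm_ket_of_eq (path_reroute x.path_isPath heq (Or.inl rfl)) (by
    rw [reroute_of_ne _ (by omega), reroute_of_ne _ (by omega), heq]) x.m
  rw [reroute_of_ne _ (show M ≠ M + 1 by omega), reroute_self, if_pos rfl, ← hs] at this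
  simp only [reroute, Function.update_idem] at this
  simp only [upperKet, lowerKet, ketWithJ_eq, ← hk, twoK_eq, reroute]
  exact this

lemma povm_lowerKet (x : SchurLabel (M + 1 + 1)) (hk : x.twoK = x.twoS) :
    act (povm (M + 1) (Fin.last M)) x.lowerKet =
      (alpha (M + 1) x.s : ℂ) •
        ((beta (M + 1) x.s : ℂ) • x.upperKet + (alpha (M + 1) x.s : ℂ) • x.lowerKet) := by
  rcases Nat.eq_zero_or_pos x.twoS with h0 | h0
  · have hs : x.s = 0 := by rw [s, h0]; simp
    rw [x.lowerKet_eq_zero h0, act_zero, hs, alpha_zero]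
    simp
  have heq : x.path M = x.path (M + 2) := by rw [← twoK_eq, ← twoS_eq, hk]
  have hpos : 0 < x.path M := by rw [← twoK_eq, hk]; exact h0
  have hs : x.s = (x.path M : ℝ) / 2 := by rw [s, ← hk, twoK_eq]
  have := povm_ket_of_eq (path_reroute x.path_isPath heq
    (Or.inr (by omega : x.path M = (x.path M - 1) + 1))) (by
    rw [reroute_of_ne _ (by omega), reroute_of_ne _ (by omega), heq]) x.m
  rw [reroute_of_ne _ (show M ≠ M + 1 by omega), reroute_self, if_neg (by omega), ← hs] at this
  simp only [reroute, Function.update_idem] at this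
  simp only [upperKet, lowerKet, ketWithJ_eq, ← hk, twoK_eq, reroute]
  exact this

lemma twoS_ne_of_twoK_eq (x : SchurLabel (M + 1 + 1)) (hk : x.twoK = x.twoS) :
    x.twoS ≠ M + 1 + 1 := by
  have := x.path_isPath.init.init.le
  rw [← hk, twoK_eq]
  omega

lemma twoJ_cases (x : SchurLabel (M + 1 + 1)) :
    x.twoS = x.twoJ + 1 ∨ x.twoJ = x.twoS + 1 := by
  rw [twoS_eq, twoJ_eq]
  exact x.path_isPath.step

lemma povm_eigVec (x : SchurLabel (M + 1 + 1)) :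
    act (povm (M + 1) (Fin.last M)) x.eigVec = ((x.eigVal : ℝ) : ℂ) • x.eigVec := by
  by_cases hk : x.twoK = x.twoS
  · have hmax := x.twoS_ne_of_twoK_eq hk
    rw [eigVec, if_pos hk, eigVal, if_neg hmax]
    by_cases hj : x.twoJ + 1 = x.twoS
    -- The rotated vector has coefficients (β, -α), orthogonal to (α, β), so the two images cancel.
    · rw [if_pos hj, if_neg (by omega), rotMinus, act_sub, act_smul, act_smul,
        povm_upperKet x hk, povm_lowerKet x hk, smul_smul, smul_smul, ← sub_smul]
      push_cast
      rw [zero_smul]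
      convert zero_smul ℂ _ using 2
      ring
    · rw [if_neg hj, if_pos ⟨hk, by have := x.twoJ_cases; omega⟩, rotPlus, act_add, act_smul,
        act_smul, povm_upperKet x hk, povm_lowerKet x hk]
      push_cast
      module
  · have hne : x.path M ≠ x.path (M + 2) := by rw [← twoK_eq, ← twoS_eq]; exact hk
    rw [eigVec, if_neg hk, schurState_eq_ket, povm_ket_of_ne x.path_isPath hne, eigVal,
      if_neg (fun h : x.twoK = x.twoS ∧ _ => hk h.1), twoS_eq]

/-- Exchange `j = s - 1/2` and `j = s + 1/2` in labels with `k = s > 0`. -/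
def flipJ (x : SchurLabel (M + 1 + 1)) : SchurLabel (M + 1 + 1) :=
  if h : x.twoK = x.twoS ∧ x.twoS ≠ 0 then
    -- Reflection of j at s. As s ≠ 0, the subtraction is never truncated.
    ofPath (reroute x.path (M + 1) (2 * x.twoS - x.twoJ)) x.m
      (path_reroute x.path_isPath (by rw [← twoK_eq, ← twoS_eq, h.1]) (by
        have h1 := x.twoJ_cases
        have h2 := h.2
        rw [← twoK_eq, h.1, Step]
        omega))
      (by rw [reroute_of_ne _ (by omega)]; exact x.m_range_path)
      (by rw [reroute_of_ne _ (by omega)]; exact x.m_parity_path)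
  else x

lemma flipJ_of_not {x : SchurLabel (M + 1 + 1)} (h : ¬ (x.twoK = x.twoS ∧ x.twoS ≠ 0)) :
    x.flipJ = x := dif_neg h

lemma path_flipJ {x : SchurLabel (M + 1 + 1)} (h : x.twoK = x.twoS ∧ x.twoS ≠ 0) {r : ℕ}
    (hr : r ≤ M + 2) :
    x.flipJ.path r = reroute x.path (M + 1) (2 * x.twoS - x.twoJ) r := by
  rw [flipJ, dif_pos h]
  exact path_ofPath _ _ _ _ _ hr

lemma m_flipJ (x : SchurLabel (M + 1 + 1)) : x.flipJ.m = x.m := by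
  by_cases h : x.twoK = x.twoS ∧ x.twoS ≠ 0
  · rw [flipJ, dif_pos h]; rfl
  · rw [flipJ_of_not h]

lemma twoK_flipJ (x : SchurLabel (M + 1 + 1)) : x.flipJ.twoK = x.twoK := by
  by_cases h : x.twoK = x.twoS ∧ x.twoS ≠ 0
  · rw [twoK_eq, path_flipJ h (by omega), reroute_of_ne _ (by omega), twoK_eq]
  · rw [flipJ_of_not h]

lemma twoS_flipJ (x : SchurLabel (M + 1 + 1)) : x.flipJ.twoS = x.twoS := by
  by_cases h : x.twoK = x.twoS ∧ x.twoS ≠ 0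
  · rw [twoS_eq, path_flipJ h (by omega), reroute_of_ne _ (by omega), twoS_eq]
  · rw [flipJ_of_not h]

lemma twoJ_flipJ {x : SchurLabel (M + 1 + 1)} (h : x.twoK = x.twoS ∧ x.twoS ≠ 0) :
    x.flipJ.twoJ = 2 * x.twoS - x.twoJ := by
  rw [twoJ_eq, path_flipJ h (by omega), reroute_self]

lemma flipJ_involutive : Function.Involutive (flipJ (M := M)) := by
  intro x
  by_cases h : x.twoK = x.twoS ∧ x.twoS ≠ 0
  · have h' : x.flipJ.twoK = x.flipJ.twoS ∧ x.flipJ.twoS ≠ 0 := by rwa [twoK_flipJ, twoS_flipJ]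
    refine ext_path (fun r hr => ?_) (by rw [m_flipJ, m_flipJ])
    rw [path_flipJ h' hr, twoS_flipJ, twoJ_flipJ h]
    by_cases hr' : r = M + 1
    · subst hr'
      have := x.twoJ_cases
      have := h.2
      rw [reroute_self, ← twoJ_eq]
      omega
    · rw [reroute_of_ne _ hr', path_flipJ h hr, reroute_of_ne _ hr']
  · rw [flipJ_of_not h, flipJ_of_not h]

/-- The coefficient of `eigVec x` at the Schur state of `x`. -/
def coeffSelf (x : SchurLabel (M + 1 + 1)) : ℝ :=
  if x.twoK = x.twoS then beta (M + 1) x.s / x.rotNorm else 1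

/-- The coefficient of `eigVec x` at the Schur state of `x.flipJ`. -/
def coeffFlip (x : SchurLabel (M + 1 + 1)) : ℝ :=
  if x.twoK = x.twoS then
    if x.twoJ + 1 = x.twoS then -(alpha (M + 1) x.s / x.rotNorm)
    else alpha (M + 1) x.s / x.rotNorm
  else 0

lemma s_flipJ (x : SchurLabel (M + 1 + 1)) : x.flipJ.s = x.s := by
  rw [s, s, twoS_flipJ]

lemma rotNorm_flipJ (x : SchurLabel (M + 1 + 1)) : x.flipJ.rotNorm = x.rotNorm := by
  rw [rotNorm, rotNorm, s_flipJ]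

lemma coeffSelf_flipJ (x : SchurLabel (M + 1 + 1)) : x.flipJ.coeffSelf = x.coeffSelf := by
  rw [coeffSelf, coeffSelf, twoK_flipJ, twoS_flipJ, s_flipJ, rotNorm_flipJ]

lemma coeffFlip_flipJ (x : SchurLabel (M + 1 + 1)) : x.flipJ.coeffFlip = -x.coeffFlip := by
  by_cases hk : x.twoK = x.twoS
  · by_cases h0 : x.twoS = 0
    · have hs : x.s = 0 := by rw [s, h0]; simp
      rw [flipJ_of_not (fun h => h.2 h0)]
      simp [coeffFlip, hs, alpha_zero]
    · have := x.twoJ_cases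
      rw [coeffFlip, coeffFlip, twoK_flipJ, twoS_flipJ, s_flipJ, rotNorm_flipJ,
        twoJ_flipJ ⟨hk, h0⟩, if_pos hk, if_pos hk]
      by_cases hj : x.twoJ + 1 = x.twoS
      · rw [if_pos hj, if_neg (by omega), neg_neg]
      · rw [if_neg hj, if_pos (by omega)]
  · rw [flipJ_of_not (fun h => hk h.1)]
    simp [coeffFlip, hk]

lemma coeff_sq_add_sq (x : SchurLabel (M + 1 + 1)) : x.coeffSelf ^ 2 + x.coeffFlip ^ 2 = 1 := by
  by_cases hk : x.twoK = x.twoS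
  · have h1 := x.rotNorm_pos
    have h2 : x.rotNorm ^ 2 = alpha (M + 1) x.s ^ 2 + beta (M + 1) x.s ^ 2 :=
      Real.sq_sqrt (by positivity)
    have h3 : x.coeffFlip ^ 2 = (alpha (M + 1) x.s / x.rotNorm) ^ 2 := by
      rw [coeffFlip, if_pos hk]
      split_ifs
      · rw [neg_sq]
      · rfl
    rw [h3, coeffSelf, if_pos hk, div_pow, div_pow, ← add_div, add_comm, ← h2,
      div_self (by positivity)]
  · simp [coeffSelf, coeffFlip, hk]

lemma schurState_flipJ {x : SchurLabel (M + 1 + 1)} (h : x.twoK = x.twoS ∧ x.twoS ≠ 0) :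
    schurState x.flipJ = x.ketWithJ (2 * x.twoS - x.twoJ) := by
  rw [schurState_eq_ket, ketWithJ_eq, m_flipJ]
  exact ket_congr (fun r hr => path_flipJ h hr) _

lemma ketWithJ_twoJ (x : SchurLabel (M + 1 + 1)) : x.ketWithJ x.twoJ = schurState x := by
  rw [ketWithJ_eq, schurState_eq_ket, reroute_eq_self (twoJ_eq x).symm]

/-- Since `rotMinus` sits at the label with the lower j and `rotPlus` at the upper one, the
coefficient at the label itself is β in both cases, and the one at the flipped label is ∓α. This is
the sign pattern that `orthonormal_rotate` requires. -/
lemma eigVec_eq (x : SchurLabel (M + 1 + 1)) :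
    x.eigVec = (x.coeffSelf : ℂ) • schurState x + (x.coeffFlip : ℂ) • schurState x.flipJ := by
  by_cases hk : x.twoK = x.twoS
  · have hc := x.twoJ_cases
    rw [eigVec, coeffSelf, coeffFlip, if_pos hk, if_pos hk, if_pos hk]
    by_cases hj : x.twoJ + 1 = x.twoS
    · rw [if_pos hj, if_pos hj, schurState_flipJ ⟨hk, by omega⟩, ← ketWithJ_twoJ, rotMinus,
        lowerKet, upperKet, show x.twoS - 1 = x.twoJ by omega,
        show 2 * x.twoS - x.twoJ = x.twoS + 1 by omega]
      push_cast
      module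
    · rw [if_neg hj, if_neg hj, rotPlus, upperKet, show x.twoS + 1 = x.twoJ by omega,
        ketWithJ_twoJ]
      -- For s = 0 the label is its own flip, and the extra term disappears because α(0) = 0.
      by_cases h0 : x.twoS = 0
      · have hs : x.s = 0 := by rw [s, h0]; simp
        rw [hs, alpha_zero]
        simp
      · rw [schurState_flipJ ⟨hk, h0⟩, lowerKet,
          show 2 * x.twoS - x.twoJ = x.twoS - 1 by omega]
        exact add_comm _ _
  · simp [eigVec, coeffSelf, coeffFlip, hk]

lemma eigVec_isONB : IsONB (eigVec (N := M + 1)) := by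
  have e : eigVec (N := M + 1) = fun x =>
      (x.coeffSelf : ℂ) • schurState x + (x.coeffFlip : ℂ) • schurState x.flipJ :=
    funext eigVec_eq
  rw [e]
  exact ⟨orthonormal_rotate schurState_orthonormal flipJ_involutive coeffSelf_flipJ
      coeffFlip_flipJ coeff_sq_add_sq,
    span_rotate flipJ_involutive coeffSelf_flipJ coeffFlip_flipJ coeff_sq_add_sq
      schurState_span⟩

end SchurLabel

/-! ### The other elements of the measurement -/

lemma swapOp_act_isONB {ι : Type} {n : ℕ} {v : ι → Qubits n} (hv : IsONB v) (a b : Fin n) :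
    IsONB fun i => act (swapOp a b) (v i) := by
  classical
  constructor
  · have h := hv.1
    rw [orthonormal_iff_ite] at h ⊢
    intro i j
    rw [← h i j, PiLp.inner_apply, PiLp.inner_apply]
    simp only [swapOp_act_apply]
    exact (Equiv.arrowCongr (Equiv.swap a b) (Equiv.refl (Fin 2))).sum_comp
      (fun x => inner ℂ (v i x) (v j x))
  · have hr : (Set.range fun i => act (swapOp a b) (v i)) =
        Matrix.toEuclideanLin (swapOp a b) '' Set.range v := by
      rw [← Set.range_comp]
      rfl
    rw [hr, Submodule.span_image, hv.2, Submodule.map_top, LinearMap.range_eq_top]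
    intro u
    refine ⟨act (swapOp a b) u, ?_⟩
    change act (swapOp a b) (act (swapOp a b) u) = u
    rw [← mul_act, swapOp_mul_self, one_act]

lemma sigma_conj {N : ℕ} (hN : 1 ≤ N) (i j l : Fin N) :
    swapOp i.castSucc j.castSucc * sigma N l * swapOp i.castSucc j.castSucc =
      sigma N (Equiv.swap i j l) := by
  have h1 : Equiv.swap i.castSucc j.castSucc l.castSucc = (Equiv.swap i j l).castSucc := by
    simp only [Equiv.swap_apply_def, Fin.castSucc_inj]
    split_ifs <;> rfl
  rw [sigma_eq N hN, sigma_eq N hN, mul_smul_comm, smul_mul_assoc, mul_sub, sub_mul, mul_one,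
    swapOp_mul_self, swapOp_conj, h1,
    Equiv.swap_apply_of_ne_of_ne (Fin.castSucc_lt_last i).ne' (Fin.castSucc_lt_last j).ne']

lemma rho_conj {N : ℕ} (hN : 1 ≤ N) (i j : Fin N) :
    swapOp i.castSucc j.castSucc * rho N * swapOp i.castSucc j.castSucc = rho N := by
  rw [rho, Finset.mul_sum, Finset.sum_mul, Finset.sum_congr rfl fun l _ => sigma_conj hN i j l]
  exact Equiv.sum_comp (Equiv.swap i j) (sigma N)

lemma rho_commute {N : ℕ} (hN : 1 ≤ N) (i j : Fin N) :
    Commute (rho N) (swapOp i.castSucc j.castSucc) := by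
  have := congrArg (swapOp i.castSucc j.castSucc * ·) (rho_conj hN i j)
  simp only [← mul_assoc, swapOp_mul_self, one_mul] at this
  exact this

/-- Exchanging two ports permutes the σ's and fixes ρ. Functional calculus passes this invariance to
ρ^{-1/2}, hence to the excess, so conjugation only replaces the middle factor σ^{(j)} by σ^{(i)}. -/
lemma povm_conj {N : ℕ} (hN : 1 ≤ N) (i j : Fin N) :
    povm N i = swapOp i.castSucc j.castSucc * povm N j * swapOp i.castSucc j.castSucc := by
  have hρ := rho_commute hN i j
  have hR : Commute (rhoInvSqrt N) (swapOp i.castSucc j.castSucc) := hρ.cfc_real _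
  have hσ := sigma_conj hN i j j
  rw [Equiv.swap_apply_right] at hσ
  have hE : Commute (excess N) (swapOp i.castSucc j.castSucc) := by
    rw [excess_eq]
    exact ((Commute.one_left _).sub_left ((hR.mul_left hρ).mul_left hR)).smul_left _
  set s := swapOp i.castSucc j.castSucc
  have hss : s * s = 1 := swapOp_mul_self _ _
  have h1 : s * (rhoInvSqrt N * sigma N j * rhoInvSqrt N) * s =
      rhoInvSqrt N * sigma N i * rhoInvSqrt N := by
    rw [← hσ]
    calc s * (rhoInvSqrt N * sigma N j * rhoInvSqrt N) * s
        = (s * rhoInvSqrt N) * sigma N j * (rhoInvSqrt N * s) := by noncomm_ring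
      _ = (rhoInvSqrt N * s) * sigma N j * (s * rhoInvSqrt N) := by rw [hR.eq]
      _ = rhoInvSqrt N * (s * sigma N j * s) * rhoInvSqrt N := by noncomm_ring
  have h2 : s * excess N * s = excess N := by
    rw [← hE.eq, mul_assoc, hss, mul_one]
  rw [povm, povm, mul_add, add_mul, h1, h2]

end

end PBT

theorem mainTheorem1 (N : ℕ) (hN : 1 ≤ N) :
    -- the kets `|k, j, s, m⟩` form the Schur (sequentially coupled spin) eigenbasis
    PBT.IsSpinEigenbasis (PBT.schurState (n := N + 1)) ∧
    -- the rotated vectors form an orthonormal basis of eigenvectors of `Π_N`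
    PBT.IsONB (PBT.SchurLabel.eigVec (N := N)) ∧
    (∀ x : PBT.SchurLabel (N + 1),
      PBT.act (PBT.povm N (PBT.lastPort N hN)) x.eigVec = ((x.eigVal : ℝ) : ℂ) • x.eigVec) ∧
    -- the nonzero eigenvalue below maximal spin
    (∀ x : PBT.SchurLabel (N + 1), x.s < ((N : ℝ) + 1) / 2 →
      PBT.alpha N x.s ^ 2 + PBT.beta N x.s ^ 2 =
        4 * ((N : ℝ) + 1) / (((N : ℝ) + 1 - 2 * x.s) * ((N : ℝ) + 3 + 2 * x.s))) ∧
    -- the other POVM elements, by conjugation with `SWAP_{A_i A_N}`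
    (∀ i : Fin N,
      PBT.povm N i =
        PBT.swapOp i.castSucc (PBT.lastPort N hN).castSucc * PBT.povm N (PBT.lastPort N hN) *
          PBT.swapOp i.castSucc (PBT.lastPort N hN).castSucc ∧
      PBT.IsONB (fun x : PBT.SchurLabel (N + 1) =>
        PBT.act (PBT.swapOp i.castSucc (PBT.lastPort N hN).castSucc) x.eigVec) ∧
      ∀ x : PBT.SchurLabel (N + 1),
        PBT.act (PBT.povm N i)
            (PBT.act (PBT.swapOp i.castSucc (PBT.lastPort N hN).castSucc) x.eigVec) =
          ((x.eigVal : ℝ) : ℂ) •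
            PBT.act (PBT.swapOp i.castSucc (PBT.lastPort N hN).castSucc) x.eigVec) := by
  obtain ⟨M, rfl⟩ : ∃ M, N = M + 1 := ⟨N - 1, by omega⟩
  have hlast : PBT.lastPort (M + 1) hN = Fin.last M := rfl
  have heig : ∀ x : PBT.SchurLabel (M + 1 + 1),
      PBT.act (PBT.povm (M + 1) (PBT.lastPort (M + 1) hN)) x.eigVec =
        ((x.eigVal : ℝ) : ℂ) • x.eigVec := fun x => by
    rw [hlast]
    exact x.povm_eigVec
  refine ⟨PBT.schurState_isSpinEigenbasis, PBT.SchurLabel.eigVec_isONB, heig,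
    fun x hx => PBT.alpha_sq_add_beta_sq _ hN x.s_nonneg hx,
    fun i => ⟨PBT.povm_conj hN i _, PBT.swapOp_act_isONB PBT.SchurLabel.eigVec_isONB _ _,
      fun x => ?_⟩⟩
  -- The inner exchange of the conjugation cancels the one applied to the eigenvector.
  rw [PBT.povm_conj hN i (PBT.lastPort (M + 1) hN), PBT.mul_act, PBT.mul_act,
    ← PBT.mul_act (PBT.swapOp _ _) (PBT.swapOp _ _), PBT.swapOp_mul_self, PBT.one_act, heig,
    PBT.act_smul]
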